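/- Let $G$ be a finite simple undirected graph. A set $S\subseteq V(G)$ is a feedback vertex set of $G$ if $G-S$ is a forest, and it is minimal if no proper subset of $S$ is a feedback vertex set of $G$. Let $\mathsf{vc}(G)$ be the vertex cover number of $G$, i.e. the minimum size of a set of vertices that meets every edge. In the problem Max Min FVS the input is a finite simple undirected graph $G$ and an integer $k\in\mathbb{N}$, and the question is whether $G$ has a minimal feedback vertex set of size at least $k$. Theorem. Max Min FVS can be solved in time $2^{O(\mathsf{vc}(G)\log \mathsf{vc}(G))}\cdot n^{O(1)}$, where $n=|V(G)|$. That is, there are one deterministic algorithm (a program of a unit-cost random access machine with addition, truncated subtraction and indirect addressing, which receives $n$, $k$ and the adjacency matrix of $G$) and constants $A,B,C\in\mathbb{N}$ such that for every $n\ge 0$, every graph $G$ with vertex set $\{0,\dots,n-1\}$ and every $k\in\mathbb{N}$ the algorithm halts on $(G,k)$ after at most $$A\cdot 2^{B\,\mathsf{vc}(G)\log_2 \mathsf{vc}(G)}\cdot (n+1)^{C}$$ steps (with $0\log_2 0=0$) and answers correctly whether $G$ has a minimal feedback vertex set of size at least $k$. -/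

import Mathlib

/-- `S` is a feedback vertex set of `G`: deleting `S` leaves a forest. -/
def SimpleGraph.IsFVS {V : Type*} (G : SimpleGraph V) (S : Finset V) : Prop :=
  (G.induce ((S : Set V)ᶜ)).IsAcyclic

/-- The question of Max Min FVS: `G` has an inclusion-minimal feedback vertex set of size at
least `k`. -/
def MaxMinFVS {V : Type*} (G : SimpleGraph V) (k : ℕ) : Prop :=
  ∃ S : Finset V, Minimal G.IsFVS S ∧ k ≤ S.card

/-- The vertex cover number as a natural number (it is finite for a finite graph, see
`vc_spec`). -/
noncomputable def vc {V : Type*} [Fintype V] (G : SimpleGraph V) : ℕ :=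
  G.vertexCoverNum.toNat

theorem vc_spec {V : Type*} [Fintype V] (G : SimpleGraph V) : (vc G : ℕ∞) = G.vertexCoverNum := by
  exact ENat.natCast_toNat SimpleGraph.vertexCoverNum_ne_top_of_finite

namespace RAM

/-- A configuration of the random access machine: registers, which a program names directly, and
a memory, which it reads and writes through addresses held in registers. All cells hold natural
numbers. -/
@[ext]
structure State where
  reg : ℕ → ℕ
  mem : ℕ → ℕ

/-- Assignment to a register. -/
def State.setReg (s : State) (x v : ℕ) : State :=
  { s with reg := Function.update s.reg x v }

/-- Assignment to a memory cell. -/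
def State.setMem (s : State) (a v : ℕ) : State :=
  { s with mem := Function.update s.mem a v }

/-- Programs of the random access machine. The arithmetic is addition and truncated subtraction;
there is no multiplication, so the unit cost measure below is polynomially related to Turing
machine time. A program names only finitely many registers. -/
inductive Prog where
  /-- no operation -/
  | skip : Prog
  /-- `r_x := c` -/
  | const (x c : ℕ) : Prog
  /-- `r_x := r_y` -/
  | move (x y : ℕ) : Prog
  /-- `r_x := r_y + r_z` -/
  | add (x y z : ℕ) : Prog
  /-- `r_x := max (r_y - r_z) 0` -/
  | sub (x y z : ℕ) : Prog
  /-- `r_x := M[r_y]` -/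
  | load (x y : ℕ) : Prog
  /-- `M[r_x] := r_y` -/
  | store (x y : ℕ) : Prog
  /-- first `p`, then `q` -/
  | seq (p q : Prog) : Prog
  /-- if `r_x ≠ 0` then `p` else `q` -/
  | ite (x : ℕ) (p q : Prog) : Prog
  /-- while `r_x ≠ 0` do `p` -/
  | loop (x : ℕ) (p : Prog) : Prog

/-- `Exec p s s' t`: the program `p`, started in `s`, halts in `s'` after exactly `t` steps. Every
elementary instruction and every evaluation of a test is one step. -/
inductive Exec : Prog → State → State → ℕ → Prop where
  | skip (s : State) : Exec .skip s s 1
  | const (x c : ℕ) (s : State) : Exec (.const x c) s (s.setReg x c) 1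
  | move (x y : ℕ) (s : State) : Exec (.move x y) s (s.setReg x (s.reg y)) 1
  | add (x y z : ℕ) (s : State) : Exec (.add x y z) s (s.setReg x (s.reg y + s.reg z)) 1
  | sub (x y z : ℕ) (s : State) : Exec (.sub x y z) s (s.setReg x (s.reg y - s.reg z)) 1
  | load (x y : ℕ) (s : State) : Exec (.load x y) s (s.setReg x (s.mem (s.reg y))) 1
  | store (x y : ℕ) (s : State) : Exec (.store x y) s (s.setMem (s.reg x) (s.reg y)) 1
  | seq {p q : Prog} {s s' s'' : State} {t t' : ℕ} :
      Exec p s s' t → Exec q s' s'' t' → Exec (.seq p q) s s'' (t + t')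
  | ite_true {x : ℕ} {p q : Prog} {s s' : State} {t : ℕ} :
      s.reg x ≠ 0 → Exec p s s' t → Exec (.ite x p q) s s' (t + 1)
  | ite_false {x : ℕ} {p q : Prog} {s s' : State} {t : ℕ} :
      s.reg x = 0 → Exec q s s' t → Exec (.ite x p q) s s' (t + 1)
  | loop_done {x : ℕ} {p : Prog} {s : State} :
      s.reg x = 0 → Exec (.loop x p) s s 1
  | loop_step {x : ℕ} {p : Prog} {s s' s'' : State} {t t' : ℕ} :
      s.reg x ≠ 0 → Exec p s s' t → Exec (.loop x p) s' s'' t' →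
        Exec (.loop x p) s s'' (t + t' + 1)

/-- The machine is deterministic: final state and number of steps are functions of program and
initial state. -/
theorem Exec.det {p : Prog} {s s₁ s₂ : State} {t₁ t₂ : ℕ}
    (h₁ : Exec p s s₁ t₁) (h₂ : Exec p s s₂ t₂) : s₁ = s₂ ∧ t₁ = t₂ := by
  induction h₁ generalizing s₂ t₂ with
  | seq _ _ ih ih' =>
    cases h₂ with
    | seq a b =>
      obtain ⟨rfl, rfl⟩ := ih a
      obtain ⟨rfl, rfl⟩ := ih' b
      exact ⟨rfl, rfl⟩
  | ite_true hx _ ih =>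
    cases h₂ with
    | ite_true _ a => obtain ⟨rfl, rfl⟩ := ih a; exact ⟨rfl, rfl⟩
    | ite_false hx' _ => exact absurd hx' hx
  | ite_false hx _ ih =>
    cases h₂ with
    | ite_true hx' _ => exact absurd hx hx'
    | ite_false _ a => obtain ⟨rfl, rfl⟩ := ih a; exact ⟨rfl, rfl⟩
  | loop_done hx =>
    cases h₂ with
    | loop_done _ => exact ⟨rfl, rfl⟩
    | loop_step hx' _ _ => exact absurd hx hx'
  | loop_step hx _ _ ih ih' =>
    cases h₂ with
    | loop_done hx' => exact absurd hx' hx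
    | loop_step _ a b =>
      obtain ⟨rfl, rfl⟩ := ih a
      obtain ⟨rfl, rfl⟩ := ih' b
      exact ⟨rfl, rfl⟩
  | _ => cases h₂; exact ⟨rfl, rfl⟩

open Classical in
/-- The input `(G, k)` for a graph `G` with vertices `0, …, n-1`: register 0 holds `n`, register 1
holds `k`, the memory holds the adjacency matrix of `G` row by row, and all else is 0. -/
noncomputable def input {n : ℕ} (G : SimpleGraph (Fin n)) (k : ℕ) : State where
  reg := fun x => if x = 0 then n else if x = 1 then k else 0
  mem := fun a => if ∃ i j : Fin n, a = i.val * n + j.val ∧ G.Adj i j then 1 else 0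

/-- On the input `(G, k)` the program `p` halts after at most `T` steps and leaves in register 0
the truth value (1 for yes, 0 for no) of `Q`. -/
def AnswersWithin (p : Prog) {n : ℕ} (G : SimpleGraph (Fin n)) (k : ℕ) (Q : Prop) (T : ℝ) : Prop :=
  ∃ (s : State) (t : ℕ), Exec p (input G k) s t ∧ (t : ℝ) ≤ T ∧
    (Q → s.reg 0 = 1) ∧ (¬ Q → s.reg 0 = 0)

end RAM

/-! Minimal feedback vertex sets are exactly the complements of inclusion-maximal induced forests
(`maxMinFVS_iff`), so the question is whether some maximal induced forest has at most n - k
vertices.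

Fix a vertex cover C; the vertices outside C are independent. Let F be a maximal forest. A vertex
outside C with at most one neighbour in F ∩ C closes no cycle, so it lies in F by maximality. The
other vertices of F \ C form a set J. Each of them has at least two neighbours in F ∩ C, and
counting the edges of a forest (`IsForest.sum_card_adj_le`) gives |J| ≤ |F ∩ C|. Thus F is
determined by F ∩ C and J, but naming the vertices of J would cost n^O(vc) guesses. Instead, they
are guessed through their adjacencies to C. Each s in C \ F has two neighbours in F in a common
component, which witness that s cannot be added. For v in J, mark its neighbours in F ∩ C and those
s that have v as a witness. Any vertex outside C that is adjacent to all marked vertices, and to no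
further vertex of F ∩ C, can take the place of v: the exchange maps F isomorphically onto a forest
that is again maximal and has the same size. This is `IsMaxForest.exists_build`.

There are O(|C|) marks in total, so a list of at most 4|C| instructions, each with one of 2|C| + 2
codes, describes such a forest. Conversely, every list yields a maximal forest after greedy
completion (`isMaxForest_build`), so wrong guesses do no harm. With C the endpoints of a greedy
maximal matching, |C| ≤ 2 vc, and the number (2|C| + 2)^(4|C|) of lists is 2^O(vc log vc)
(`pow_search_bound`).

The search is written in a small language of bounded loops. `Stmt.exec_compile` carries it to the
machine, and `Stmt.cost_le` makes its running time polynomial in a common bound on all loop lengths.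
That bound is linear in (n + 1) times the number of lists, so only a constant power of this number
is lost. -/

set_option linter.constructorNameAsVariable false

/-! ### A language of bounded loops and its compilation to the machine. -/

namespace RAM

/-- Variables of the source language. -/
inductive Var
  | n | k | i | j | c | b | pow | acc | w | z | y | t | q | v | u | ok | x | g | cnt | ans | d
  deriving DecidableEq

/-- Arrays of the source language. -/
inductive Arr
  | row | cov | lst | lab | mark | seen
  deriving DecidableEq

/-- The register that holds a variable. -/
def Var.idx : Var → ℕ
  | .n => 0 | .k => 1 | .i => 2 | .j => 3 | .c => 4 | .b => 5 | .pow => 6 | .acc => 7 | .w => 8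
  | .z => 9 | .y => 10 | .t => 11 | .q => 12 | .v => 13 | .u => 14 | .ok => 15 | .x => 16
  | .g => 17 | .cnt => 18 | .ans => 19 | .d => 20

/-- The residue modulo 8 of the cells of an array. -/
def Arr.idx : Arr → ℕ
  | .row => 0 | .cov => 1 | .lst => 2 | .lab => 3 | .mark => 4 | .seen => 5

theorem Var.idx_injective : Function.Injective Var.idx := by
  intro x y
  cases x <;> cases y <;> simp [Var.idx]

/-- The register that holds the address of the first cell behind the input. -/
abbrev baseReg : ℕ := 21

theorem Var.idx_lt (x : Var) : x.idx < baseReg := by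
  cases x <;> simp [Var.idx, baseReg]

theorem Arr.idx_injective : Function.Injective Arr.idx := by
  intro x y
  cases x <;> cases y <;> simp [Arr.idx]

theorem Arr.idx_lt (a : Arr) : a.idx < 8 := by
  cases a <;> simp [Arr.idx]

/-- Expressions of the source language; `inp e` is the input cell number `e`. -/
inductive Expr
  | lit (c : ℕ)
  | var (x : Var)
  | add (e f : Expr)
  | sub (e f : Expr)
  | get (a : Arr) (e : Expr)
  | inp (e : Expr)

/-- Statements of the source language; all loops are bounded. -/
inductive Stmt
  | skip
  | set (x : Var) (e : Expr)
  | put (a : Arr) (e f : Expr)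
  | seq (p q : Stmt)
  | ite (e : Expr) (p q : Stmt)
  | loop (i x : Var) (p : Stmt)

/-- Environments of the source language. -/
@[ext]
structure Env where
  var : Var → ℕ
  arr : Arr → ℕ → ℕ

def Env.set (s : Env) (x : Var) (v : ℕ) : Env :=
  { s with var := Function.update s.var x v }

def Env.put (s : Env) (a : Arr) (i v : ℕ) : Env :=
  { s with arr := Function.update s.arr a (Function.update (s.arr a) i v) }

theorem Env.set_var (s : Env) (x y : Var) (v : ℕ) :
    (s.set x v).var y = if y = x then v else s.var y := by
  simp [Env.set, Function.update_apply]

theorem Env.set_arr (s : Env) (x : Var) (v : ℕ) : (s.set x v).arr = s.arr := rfl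

theorem Env.put_var (s : Env) (a : Arr) (i v : ℕ) : (s.put a i v).var = s.var := rfl

theorem Env.put_arr (s : Env) (a b : Arr) (i j v : ℕ) :
    (s.put a i v).arr b j = if b = a ∧ j = i then v else s.arr b j := by
  simp only [Env.put, Function.update_apply]
  split_ifs <;> simp_all

theorem Env.put_arr_of_ne (s : Env) {a b : Arr} (i v : ℕ) (h : b ≠ a) :
    (s.put a i v).arr b = s.arr b := by
  simp [Env.put, h]

def Expr.eval (M : ℕ → ℕ) (s : Env) : Expr → ℕ
  | .lit c => c
  | .var x => s.var x
  | .add e f => e.eval M s + f.eval M s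
  | .sub e f => e.eval M s - f.eval M s
  | .get a e => s.arr a (e.eval M s)
  | .inp e => M (e.eval M s)

/-- `repeatBody i f m s` performs `f` on `s` for `i = 0, …, m - 1`. -/
def repeatBody (i : Var) (f : Env → Env) : ℕ → Env → Env
  | 0, s => s
  | m + 1, s => f ((repeatBody i f m s).set i m)

def Stmt.eval (M : ℕ → ℕ) : Stmt → Env → Env
  | .skip, s => s
  | .set x e, s => s.set x (e.eval M s)
  | .put a e f, s => s.put a (e.eval M s) (f.eval M s)
  | .seq p q, s => q.eval M (p.eval M s)
  | .ite e p q, s => if e.eval M s ≠ 0 then p.eval M s else q.eval M s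
  | .loop i x p, s => repeatBody i (p.eval M) (s.var x) s

theorem Stmt.eval_seq (M : ℕ → ℕ) (p q : Stmt) (s : Env) :
    (Stmt.seq p q).eval M s = q.eval M (p.eval M s) := rfl

theorem Stmt.eval_ite_pos {M : ℕ → ℕ} {e : Expr} {s : Env} (h : e.eval M s ≠ 0) (p q : Stmt) :
    (Stmt.ite e p q).eval M s = p.eval M s := if_pos h

theorem Stmt.eval_ite_neg {M : ℕ → ℕ} {e : Expr} {s : Env} (h : ¬ e.eval M s ≠ 0) (p q : Stmt) :
    (Stmt.ite e p q).eval M s = q.eval M s := if_neg h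

/-! ### Frame properties -/

/-- `p.writes x`: the statement `p` contains an assignment to `x`. -/
def Stmt.writes (x : Var) : Stmt → Bool
  | .skip => false
  | .set y _ => x = y
  | .put _ _ _ => false
  | .seq p q => p.writes x || q.writes x
  | .ite _ p q => p.writes x || q.writes x
  | .loop i _ p => x = i || p.writes x

/-- `p.writesArr a`: the statement `p` contains an assignment to a cell of `a`. -/
def Stmt.writesArr (a : Arr) : Stmt → Bool
  | .skip => false
  | .set _ _ => false
  | .put a' _ _ => a = a'
  | .seq p q => p.writesArr a || q.writesArr a
  | .ite _ p q => p.writesArr a || q.writesArr a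
  | .loop _ _ p => p.writesArr a

theorem repeatBody_var {i y : Var} {f : Env → Env} (hy : y ≠ i)
    (hf : ∀ s, (f s).var y = s.var y) (m : ℕ) (s : Env) :
    (repeatBody i f m s).var y = s.var y := by
  induction m with
  | zero => rfl
  | succ m ih => simp [repeatBody, hf, Env.set_var, hy, ih]

theorem repeatBody_arr {i : Var} {a : Arr} {f : Env → Env}
    (hf : ∀ s, (f s).arr a = s.arr a) (m : ℕ) (s : Env) :
    (repeatBody i f m s).arr a = s.arr a := by
  induction m with
  | zero => rfl
  | succ m ih => simp [repeatBody, hf, Env.set_arr, ih]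

theorem Stmt.eval_var (M : ℕ → ℕ) {x : Var} {p : Stmt} (h : p.writes x = false) (s : Env) :
    (p.eval M s).var x = s.var x := by
  induction p generalizing s with
  | skip => rfl
  | set y e =>
    have : x ≠ y := by simpa [Stmt.writes] using h
    simp [Stmt.eval, Env.set_var, this]
  | put a e f => rfl
  | seq p q ihp ihq =>
    simp only [Stmt.writes, Bool.or_eq_false_iff] at h
    simp [Stmt.eval, ihp h.1, ihq h.2]
  | ite e p q ihp ihq =>
    simp only [Stmt.writes, Bool.or_eq_false_iff] at h
    simp only [Stmt.eval]
    split_ifs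
    · exact ihp h.1 s
    · exact ihq h.2 s
  | loop i y p ih =>
    simp only [Stmt.writes, Bool.or_eq_false_iff, decide_eq_false_iff_not] at h
    exact repeatBody_var h.1 (ih h.2) _ _

theorem Stmt.eval_arr (M : ℕ → ℕ) {a : Arr} {p : Stmt} (h : p.writesArr a = false) (s : Env) :
    (p.eval M s).arr a = s.arr a := by
  induction p generalizing s with
  | skip => rfl
  | set y e => rfl
  | put a' e f =>
    have : a ≠ a' := by simpa [Stmt.writesArr] using h
    exact Env.put_arr_of_ne _ _ _ this
  | seq p q ihp ihq =>
    simp only [Stmt.writesArr, Bool.or_eq_false_iff] at h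
    simp [Stmt.eval, ihp h.1, ihq h.2]
  | ite e p q ihp ihq =>
    simp only [Stmt.writesArr, Bool.or_eq_false_iff] at h
    simp only [Stmt.eval]
    split_ifs
    · exact ihp h.1 s
    · exact ihq h.2 s
  | loop i y p ih => exact repeatBody_arr (ih h) _ _

/-- The invariant rule for loops. The invariant need not mention what the loop never writes. -/
theorem Stmt.loop_rule (M : ℕ → ℕ) {i x : Var} {p : Stmt} {s : Env} (Inv : ℕ → Env → Prop)
    (h0 : Inv 0 s)
    (step : ∀ m < s.var x, ∀ s' : Env,
      (∀ y, (Stmt.loop i x p).writes y = false → s'.var y = s.var y) →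
      (∀ a, (Stmt.loop i x p).writesArr a = false → s'.arr a = s.arr a) →
      Inv m s' → Inv (m + 1) (p.eval M (s'.set i m))) :
    Inv (s.var x) ((Stmt.loop i x p).eval M s) := by
  have key : ∀ m ≤ s.var x, Inv m (repeatBody i (p.eval M) m s) := by
    intro m
    induction m with
    | zero => exact fun _ => h0
    | succ m ih =>
      intro hm
      refine step m hm _ (fun y hy => ?_) (fun a ha => ?_) (ih (by omega))
      · simp only [Stmt.writes, Bool.or_eq_false_iff, decide_eq_false_iff_not] at hy
        exact repeatBody_var hy.1 (fun s => Stmt.eval_var M hy.2 s) _ _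
      · exact repeatBody_arr (fun s => Stmt.eval_arr M (p := p) ha s) _ _
  exact key _ le_rfl

/-! ### Compilation -/

/-- Turns an index in register `t` into the address of the cell of `a`. -/
def Arr.address (a : Arr) (t : ℕ) : Prog :=
  .seq (.add t t t) (.seq (.add t t t) (.seq (.add t t t) (.seq (.const (t + 1) a.idx)
    (.seq (.add t t (t + 1)) (.add t t baseReg)))))

/-- Code that leaves the value of an expression in register `t`. -/
def Expr.compile : Expr → ℕ → Prog
  | .lit c, t => .const t c
  | .var x, t => .move t x.idx
  | .add e f, t => .seq (e.compile t) (.seq (f.compile (t + 1)) (.add t t (t + 1)))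
  | .sub e f, t => .seq (e.compile t) (.seq (f.compile (t + 1)) (.sub t t (t + 1)))
  | .get a e, t => .seq (e.compile t) (.seq (a.address t) (.load t t))
  | .inp e, t => .seq (e.compile t) (.seq (.sub (t + 1) baseReg t)
      (.ite (t + 1) (.load t t) (.const t 0)))

/-- Code for a statement that uses no scratch registers below `t`. -/
def Stmt.compile : Stmt → ℕ → Prog
  | .skip, _ => .skip
  | .set x e, t => .seq (e.compile t) (.move x.idx t)
  | .put a e f, t => .seq (e.compile t) (.seq (a.address t)
      (.seq (f.compile (t + 1)) (.store t (t + 1))))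
  | .seq p q, t => .seq (p.compile t) (q.compile t)
  | .ite e p q, t => .seq (e.compile t) (.ite t (p.compile t) (q.compile t))
  | .loop i x p, t => .seq (.move t x.idx) (.seq (.const (t + 1) 0)
      (.loop t (.seq (.move i.idx (t + 1)) (.seq (p.compile (t + 2))
        (.seq (.const (t + 2) 1) (.seq (.add (t + 1) (t + 1) (t + 2)) (.sub t t (t + 2))))))))

/-- The machine state `s` represents the environment `e`, behind an input of `N` cells. -/
structure Represents (M : ℕ → ℕ) (N : ℕ) (s : State) (e : Env) : Prop where
  var : ∀ x : Var, s.reg x.idx = e.var x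
  base : s.reg baseReg = N
  arr : ∀ a i, s.mem (N + (8 * i + a.idx)) = e.arr a i
  inp : ∀ i < N, s.mem i = M i
  inp_zero : ∀ i, N ≤ i → M i = 0

def Expr.cost : Expr → ℕ
  | .lit _ => 1
  | .var _ => 1
  | .add e f => e.cost + f.cost + 1
  | .sub e f => e.cost + f.cost + 1
  | .get _ e => e.cost + 7
  | .inp e => e.cost + 3

theorem Arr.exec_address (a : Arr) {t : ℕ} (ht : baseReg < t) (s : State) :
    ∃ s', Exec (a.address t) s s' 6 ∧ s'.mem = s.mem ∧
      s'.reg t = s.reg baseReg + (8 * s.reg t + a.idx) ∧ ∀ r < t, s'.reg r = s.reg r := by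
  have h1 : baseReg ≠ t := by omega
  have h2 : baseReg ≠ t + 1 := by omega
  refine ⟨_, .seq (.add _ _ _ _) (.seq (.add _ _ _ _) (.seq (.add _ _ _ _)
    (.seq (.const _ _ _) (.seq (.add _ _ _ _) (.add _ _ _ _))))), rfl, ?_, fun r hr => ?_⟩
  · simp [State.setReg, h1, h2]
    ring
  · have h3 : r ≠ t := by omega
    have h4 : r ≠ t + 1 := by omega
    simp [State.setReg, Function.update_apply, h3, h4]

/-- Scratch registers are not part of the representation, so code that touches only registers from t
upwards preserves it. -/
theorem Represents.of_eq {M : ℕ → ℕ} {N : ℕ} {s s' : State} {e : Env} (h : Represents M N s e)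
    (hm : s'.mem = s.mem) {t : ℕ} (ht : baseReg < t) (hr : ∀ r < t, s'.reg r = s.reg r) :
    Represents M N s' e where
  var x := by rw [hr _ (by have := x.idx_lt; omega), h.var]
  base := by rw [hr _ ht, h.base]
  arr a i := by rw [hm, h.arr]
  inp i hi := by rw [hm, h.inp i hi]
  inp_zero := h.inp_zero

/-- The registers from t upwards serve as an evaluation stack: everything below t survives, so the
left operand is still in t while the right one is computed in t + 1. -/
theorem Expr.exec_compile {M : ℕ → ℕ} {N : ℕ} {env : Env} (e : Expr) {t : ℕ} (ht : baseReg < t)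
    {s : State} (h : Represents M N s env) :
    ∃ s' τ, Exec (e.compile t) s s' τ ∧ τ ≤ e.cost ∧ s'.mem = s.mem ∧
      s'.reg t = e.eval M env ∧ ∀ r < t, s'.reg r = s.reg r := by
  induction e generalizing t s with
  | lit c =>
    refine ⟨_, _, .const _ _ _, le_rfl, rfl, by simp [State.setReg, Expr.eval], fun r hr => ?_⟩
    simp [State.setReg, hr.ne]
  | var x =>
    refine ⟨_, _, .move _ _ _, le_rfl, rfl, by simp [State.setReg, Expr.eval, h.var],
      fun r hr => ?_⟩
    simp [State.setReg, hr.ne]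
  | add e f ihe ihf =>
    obtain ⟨s₁, τ₁, x₁, c₁, m₁, v₁, r₁⟩ := ihe ht h
    obtain ⟨s₂, τ₂, x₂, c₂, m₂, v₂, r₂⟩ := ihf (t := t + 1) (by omega) (h.of_eq m₁ ht r₁)
    refine ⟨_, _, .seq x₁ (.seq x₂ (.add _ _ _ _)), by simp only [Expr.cost]; omega,
      by simp [State.setReg, m₁, m₂], ?_, fun r hr => ?_⟩
    · simp [State.setReg, Expr.eval, v₂, r₂ t (by omega), v₁]
    · simp [State.setReg, hr.ne, r₂ r (by omega), r₁ r hr]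
  | sub e f ihe ihf =>
    obtain ⟨s₁, τ₁, x₁, c₁, m₁, v₁, r₁⟩ := ihe ht h
    obtain ⟨s₂, τ₂, x₂, c₂, m₂, v₂, r₂⟩ := ihf (t := t + 1) (by omega) (h.of_eq m₁ ht r₁)
    refine ⟨_, _, .seq x₁ (.seq x₂ (.sub _ _ _ _)), by simp only [Expr.cost]; omega,
      by simp [State.setReg, m₁, m₂], ?_, fun r hr => ?_⟩
    · simp [State.setReg, Expr.eval, v₂, r₂ t (by omega), v₁]
    · simp [State.setReg, hr.ne, r₂ r (by omega), r₁ r hr]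
  | get a e ih =>
    obtain ⟨s₁, τ₁, x₁, c₁, m₁, v₁, r₁⟩ := ih ht h
    obtain ⟨s₂, x₂, m₂, v₂, r₂⟩ := a.exec_address ht s₁
    refine ⟨_, _, .seq x₁ (.seq x₂ (.load _ _ _)), by simp only [Expr.cost]; omega,
      by simp [State.setReg, m₁, m₂], ?_, fun r hr => ?_⟩
    · simp only [State.setReg, Function.update_self, Expr.eval]
      rw [v₂, m₂, m₁, v₁, r₁ _ ht, h.base, h.arr]
    · simp [State.setReg, hr.ne, r₂ r hr, r₁ r hr]
  | inp e ih =>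
    obtain ⟨s₁, τ₁, x₁, c₁, m₁, v₁, r₁⟩ := ih ht h
    have hb : s₁.reg baseReg = N := by rw [r₁ _ ht, h.base]
    -- The cells from N on hold the arrays, so a read beyond the input must be intercepted; the
    -- input function vanishes there.
    by_cases hlt : e.eval M env < N
    · refine ⟨_, _, .seq x₁ (.seq (.sub _ _ _ _) (.ite_true ?_ (.load _ _ _))),
        by simp only [Expr.cost]; omega, by simp [State.setReg, m₁], ?_, fun r hr => ?_⟩
      · simp [State.setReg, hb, v₁]; omega
      · simp [State.setReg, Expr.eval, v₁, m₁, h.inp _ hlt]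
      · simp [State.setReg, hr.ne, r₁ r hr, Function.update_apply]
        omega
    · refine ⟨_, _, .seq x₁ (.seq (.sub _ _ _ _) (.ite_false ?_ (.const _ _ _))),
        by simp only [Expr.cost]; omega, by simp [State.setReg, m₁], ?_, fun r hr => ?_⟩
      · simp [State.setReg, hb, v₁]; omega
      · simp [State.setReg, Expr.eval, h.inp_zero _ (not_lt.1 hlt)]
      · simp [State.setReg, hr.ne, r₁ r hr, Function.update_apply]
        omega

/-- Every loop bound of the statement satisfies `B`, and no variable with `B` is written. -/
def Stmt.BoundedBy (B : Var → Bool) : Stmt → Bool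
  | .skip => true
  | .set x _ => !B x
  | .put _ _ _ => true
  | .seq p q => p.BoundedBy B && q.BoundedBy B
  | .ite _ p q => p.BoundedBy B && q.BoundedBy B
  | .loop i x p => !B i && (B x && p.BoundedBy B)

/-- Time bound for a statement all of whose loops run at most `m` times. -/
def Stmt.cost (m : ℕ) : Stmt → ℕ
  | .skip => 1
  | .set _ e => e.cost + 1
  | .put _ e f => e.cost + f.cost + 7
  | .seq p q => p.cost m + q.cost m
  | .ite e p q => e.cost + p.cost m + q.cost m + 1
  | .loop _ _ p => m * (p.cost m + 5) + 3

theorem Stmt.writes_of_boundedBy {B : Var → Bool} {p : Stmt} (hp : p.BoundedBy B) {x : Var}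
    (hx : B x) : p.writes x = false := by
  induction p with
  | skip => rfl
  | set y e =>
    simp only [Stmt.BoundedBy, Bool.not_eq_true'] at hp
    simp only [Stmt.writes, decide_eq_false_iff_not]
    rintro rfl
    simp_all
  | put a e f => rfl
  | seq p q ihp ihq =>
    simp only [Stmt.BoundedBy, Bool.and_eq_true] at hp
    simp [Stmt.writes, ihp hp.1, ihq hp.2]
  | ite e p q ihp ihq =>
    simp only [Stmt.BoundedBy, Bool.and_eq_true] at hp
    simp [Stmt.writes, ihp hp.1, ihq hp.2]
  | loop i y p ih =>
    simp only [Stmt.BoundedBy, Bool.and_eq_true, Bool.not_eq_true'] at hp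
    simp only [Stmt.writes, ih hp.2.2, Bool.or_false, decide_eq_false_iff_not]
    rintro rfl
    simp_all

theorem Represents.set {M : ℕ → ℕ} {N : ℕ} {s : State} {e : Env} (h : Represents M N s e)
    (x : Var) (v : ℕ) : Represents M N (s.setReg x.idx v) (e.set x v) where
  var y := by
    simp only [State.setReg, Env.set, Function.update_apply, Var.idx_injective.eq_iff, h.var]
  base := by
    have := x.idx_lt
    simp only [State.setReg, Function.update_apply, h.base]
    rw [if_neg (by omega)]
  arr := h.arr
  inp := h.inp
  inp_zero := h.inp_zero

theorem Represents.put {M : ℕ → ℕ} {N : ℕ} {s : State} {e : Env} (h : Represents M N s e)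
    (a : Arr) (i v : ℕ) :
    Represents M N (s.setMem (N + (8 * i + a.idx)) v) (e.put a i v) where
  var := h.var
  base := h.base
  arr b j := by
    simp only [State.setMem, Env.put_arr, Function.update_apply]
    by_cases hab : b = a ∧ j = i
    · simp [hab]
    · rw [if_neg hab, if_neg, h.arr]
      intro heq
      have h1 := a.idx_lt
      have h2 := b.idx_lt
      exact hab ⟨Arr.idx_injective (by omega), by omega⟩
  inp j hj := by
    simp only [State.setMem, Function.update_apply]
    rw [if_neg (by omega), h.inp j hj]
  inp_zero := h.inp_zero

/-- The preserved registers between `baseReg` and t let the two counters of a loop, kept in t and t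
+ 1, survive a body compiled at t + 2. The bound m has to be checked only in the initial
environment, because variables that satisfy `B` are never written. -/
theorem Stmt.exec_compile {M : ℕ → ℕ} {N m : ℕ} {B : Var → Bool} (p : Stmt)
    (hp : p.BoundedBy B) {t : ℕ} (ht : baseReg < t) {s : State} {env : Env}
    (h : Represents M N s env) (hB : ∀ x, B x → env.var x ≤ m) :
    ∃ s' τ, Exec (p.compile t) s s' τ ∧ τ ≤ p.cost m ∧ Represents M N s' (p.eval M env) ∧
      ∀ r, baseReg < r → r < t → s'.reg r = s.reg r := by
  induction p generalizing t s env with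
  | skip => exact ⟨_, _, .skip _, le_rfl, h, fun _ _ _ => rfl⟩
  | set x e =>
    obtain ⟨s₁, τ₁, x₁, c₁, m₁, v₁, r₁⟩ := e.exec_compile ht h
    refine ⟨_, _, .seq x₁ (.move _ _ _), by simp only [Stmt.cost]; omega, ?_, fun r hr hrt => ?_⟩
    · rw [v₁]
      exact (h.of_eq m₁ ht r₁).set _ _
    · have := x.idx_lt
      simp only [State.setReg, Function.update_apply]
      rw [if_neg (by omega), r₁ r hrt]
  | put a e f =>
    obtain ⟨s₁, τ₁, x₁, c₁, m₁, v₁, r₁⟩ := e.exec_compile ht h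
    obtain ⟨s₂, x₂, m₂, v₂, r₂⟩ := a.exec_address ht s₁
    have h₂ := (h.of_eq m₁ ht r₁).of_eq m₂ ht r₂
    obtain ⟨s₃, τ₃, x₃, c₃, m₃, v₃, r₃⟩ := f.exec_compile (t := t + 1) (by omega) h₂
    refine ⟨_, _, .seq x₁ (.seq x₂ (.seq x₃ (.store _ _ _))), by simp only [Stmt.cost]; omega,
      ?_, fun r hr hrt => ?_⟩
    · have h₃ := h₂.of_eq m₃ (by omega) r₃
      rw [v₃, r₃ t (by omega), v₂, v₁, r₁ _ ht, h.base]
      exact h₃.put _ _ _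
    · simp only [State.setMem]
      rw [r₃ r (by omega), r₂ r hrt, r₁ r hrt]
  | seq p q ihp ihq =>
    simp only [Stmt.BoundedBy, Bool.and_eq_true] at hp
    obtain ⟨s₁, τ₁, x₁, c₁, h₁, r₁⟩ := ihp hp.1 ht h hB
    obtain ⟨s₂, τ₂, x₂, c₂, h₂, r₂⟩ := ihq hp.2 ht h₁ (fun x hx => by
      rw [Stmt.eval_var M (Stmt.writes_of_boundedBy hp.1 hx)]
      exact hB x hx)
    refine ⟨_, _, .seq x₁ x₂, by simp only [Stmt.cost]; omega, h₂, fun r hr hrt => ?_⟩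
    rw [r₂ r hr hrt, r₁ r hr hrt]
  | ite e p q ihp ihq =>
    simp only [Stmt.BoundedBy, Bool.and_eq_true] at hp
    obtain ⟨s₁, τ₁, x₁, c₁, m₁, v₁, r₁⟩ := e.exec_compile ht h
    have h₁ := h.of_eq m₁ ht r₁
    by_cases he : e.eval M env ≠ 0
    · obtain ⟨s₂, τ₂, x₂, c₂, h₂, r₂⟩ := ihp hp.1 ht h₁ hB
      refine ⟨_, _, .seq x₁ (.ite_true (by rwa [v₁]) x₂), by simp only [Stmt.cost]; omega, ?_,
        fun r hr hrt => by rw [r₂ r hr hrt, r₁ r hrt]⟩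
      simpa only [Stmt.eval, if_pos he] using h₂
    · obtain ⟨s₂, τ₂, x₂, c₂, h₂, r₂⟩ := ihq hp.2 ht h₁ hB
      refine ⟨_, _, .seq x₁ (.ite_false (by rw [v₁]; exact not_not.1 he) x₂),
        by simp only [Stmt.cost]; omega, ?_, fun r hr hrt => by rw [r₂ r hr hrt, r₁ r hrt]⟩
      simpa only [Stmt.eval, if_neg he] using h₂
  | loop i x p ih =>
    simp only [Stmt.BoundedBy, Bool.and_eq_true, Bool.not_eq_true'] at hp
    obtain ⟨hi, hx, hp⟩ := hp
    set body : Prog := .seq (.move i.idx (t + 1)) (.seq (p.compile (t + 2))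
        (.seq (.const (t + 2) 1) (.seq (.add (t + 1) (t + 1) (t + 2)) (.sub t t (t + 2)))))
      with hbody
    -- Induction on the number d of remaining rounds with l rounds done: `repeatBody` unfolds from
    -- its last round, whereas the machine runs from the first.
    have key : ∀ d l s, d + l = env.var x →
        Represents M N s (repeatBody i (p.eval M) l env) → s.reg t = d → s.reg (t + 1) = l →
        ∃ s' τ, Exec (.loop t body) s s' τ ∧ τ ≤ d * (p.cost m + 5) + 1 ∧
          Represents M N s' (repeatBody i (p.eval M) (env.var x) env) ∧
          ∀ r, baseReg < r → r < t → s'.reg r = s.reg r := by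
      intro d
      induction d with
      | zero =>
        intro l s hl hs h1 h2
        obtain rfl : l = env.var x := by omega
        exact ⟨s, 1, .loop_done h1, by omega, hs, fun _ _ _ => rfl⟩
      | succ d ihd =>
        intro l s hl hs h1 h2
        have hs₁ := hs.set i l
        have hB₁ : ∀ y, B y → ((repeatBody i (p.eval M) l env).set i l).var y ≤ m := by
          intro y hy
          have hyi : y ≠ i := by rintro rfl; simp_all
          rw [Env.set_var, if_neg hyi,
            repeatBody_var hyi (Stmt.eval_var M (Stmt.writes_of_boundedBy hp hy))]
          exact hB y hy
        obtain ⟨s₂, τ₂, x₂, c₂, h₂, r₂⟩ := ih hp (t := t + 2) (by omega) hs₁ hB₁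
        have := i.idx_lt
        have e1 : s₂.reg t = d + 1 := by
          rw [r₂ t ht (by omega)]
          simp only [State.setReg, Function.update_apply]
          rw [if_neg (by omega), h1]
        have e2 : s₂.reg (t + 1) = l := by
          rw [r₂ (t + 1) (by omega) (by omega)]
          simp only [State.setReg, Function.update_apply]
          rw [if_neg (by omega), h2]
        have x₃ : Exec body s _ _ := .seq (.move _ _ _) (.seq (h2 ▸ x₂)
          (.seq (.const _ _ _) (.seq (.add _ _ _ _) (.sub _ _ _ _))))
        set s₃ := (((s₂.setReg (t + 2) 1).setReg (t + 1)
          ((s₂.setReg (t + 2) 1).reg (t + 1) + (s₂.setReg (t + 2) 1).reg (t + 2)))) with hs₃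
        set s₄ := s₃.setReg t (s₃.reg t - s₃.reg (t + 2)) with hs₄
        have f1 : s₄.reg t = d := by
          simp [hs₄, hs₃, State.setReg, e1]
        have f2 : s₄.reg (t + 1) = l + 1 := by
          simp [hs₄, hs₃, State.setReg, e2]
        have f3 : ∀ r < t, s₄.reg r = s₂.reg r := by
          intro r hr
          simp only [hs₄, hs₃, State.setReg, Function.update_apply]
          rw [if_neg (by omega), if_neg (by omega), if_neg (by omega)]
        obtain ⟨s₅, τ₅, x₅, c₅, h₅, r₅⟩ := ihd (l + 1) s₄ (by omega)
          (h₂.of_eq rfl ht f3) f1 f2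
        refine ⟨s₅, _, .loop_step (by omega) x₃ x₅, ?_, h₅, fun r hr hrt => ?_⟩
        · rw [Nat.succ_mul]; omega
        · rw [r₅ r hr hrt, f3 r hrt, r₂ r hr (by omega)]
          simp only [State.setReg, Function.update_apply]
          rw [if_neg (by omega)]
    set s₂ := (s.setReg t (s.reg x.idx)).setReg (t + 1) 0 with hs₂
    have g : ∀ r < t, s₂.reg r = s.reg r := by
      intro r hr
      simp only [hs₂, State.setReg, Function.update_apply]
      rw [if_neg (by omega), if_neg (by omega)]
    obtain ⟨s₃, τ₃, x₃, c₃, h₃, r₃⟩ := key (env.var x) 0 s₂ rfl (h.of_eq rfl ht g)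
      (by simp [hs₂, State.setReg, h.var]) (by simp [hs₂, State.setReg])
    refine ⟨s₃, _, .seq (.move _ _ _) (.seq (.const _ _ _) x₃), ?_, h₃, fun r hr hrt => ?_⟩
    · have : env.var x * (p.cost m + 5) ≤ m * (p.cost m + 5) := Nat.mul_le_mul_right _ (hB x hx)
      simp only [Stmt.cost]
      omega
    · rw [r₃ r hr hrt, g r hrt]

/-- Only loops raise the degree, each by one; sequences and branches add constants and take the
larger exponent. -/
theorem Stmt.cost_le (p : Stmt) : ∃ K D : ℕ, ∀ m, p.cost m ≤ K * (m + 1) ^ D := by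
  have one : ∀ m D : ℕ, 1 ≤ (m + 1) ^ D := fun m D => Nat.one_le_pow _ _ (by omega)
  have mono : ∀ K D D' m : ℕ, D ≤ D' → K * (m + 1) ^ D ≤ K * (m + 1) ^ D' := fun K D D' m hD =>
    Nat.mul_le_mul_left _ (Nat.pow_le_pow_right (by omega) hD)
  induction p with
  | skip => exact ⟨1, 0, fun m => by simp [Stmt.cost]⟩
  | set x e => exact ⟨e.cost + 1, 0, fun m => by simp [Stmt.cost]⟩
  | put a e f => exact ⟨e.cost + f.cost + 7, 0, fun m => by simp [Stmt.cost]⟩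
  | seq p q ihp ihq =>
    obtain ⟨K, D, h⟩ := ihp
    obtain ⟨K', D', h'⟩ := ihq
    refine ⟨K + K', max D D', fun m => ?_⟩
    have := h m
    have := h' m
    have := mono K D (max D D') m (le_max_left _ _)
    have := mono K' D' (max D D') m (le_max_right _ _)
    simp only [Stmt.cost, Nat.add_mul]
    omega
  | ite e p q ihp ihq =>
    obtain ⟨K, D, h⟩ := ihp
    obtain ⟨K', D', h'⟩ := ihq
    refine ⟨e.cost + 1 + K + K', max D D', fun m => ?_⟩
    have := h m
    have := h' m
    have := mono K D (max D D') m (le_max_left _ _)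
    have := mono K' D' (max D D') m (le_max_right _ _)
    have := Nat.mul_le_mul_left (e.cost + 1) (one m (max D D'))
    rw [Nat.add_mul, Nat.add_mul]
    simp only [Stmt.cost]
    omega
  | loop i x p ih =>
    obtain ⟨K, D, h⟩ := ih
    refine ⟨K + 8, D + 1, fun m => ?_⟩
    have h1 := h m
    have h2 := one m D
    simp only [Stmt.cost, pow_succ]
    nlinarith

end RAM

/-! ### Induced forests, their one-vertex extensions, and maximality. -/

namespace SimpleGraph

variable {V : Type*} {G : SimpleGraph V} {F F' : Finset V}

/-- The edges of `G` with both ends in `F`, as a graph on all vertices. -/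
def within (G : SimpleGraph V) (F : Finset V) : SimpleGraph V where
  Adj u v := G.Adj u v ∧ u ∈ F ∧ v ∈ F
  symm := ⟨fun _ _ h => ⟨h.1.symm, h.2.2, h.2.1⟩⟩
  loopless := ⟨fun _ h => h.1.ne rfl⟩

/-- `F` induces a forest. -/
def IsForest (G : SimpleGraph V) (F : Finset V) : Prop := (G.within F).IsAcyclic

theorem within_mono (h : F ⊆ F') : G.within F ≤ G.within F' :=
  fun _ _ hab => ⟨hab.1, h hab.2.1, h hab.2.2⟩

theorem IsForest.mono (h : G.IsForest F') (hs : F ⊆ F') : G.IsForest F :=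
  IsAcyclic.anti (within_mono hs) h

theorem isForest_empty : G.IsForest ∅ := by
  have : G.within ∅ = ⊥ := by
    ext a b
    simp [within]
  rw [IsForest, this]
  exact isAcyclic_bot

/-- Every vertex of a cycle lies on one of its edges, so a cycle of `within` stays inside F and
restricts to the induced graph. -/
theorem isForest_iff_isAcyclic_induce : G.IsForest F ↔ (G.induce (F : Set V)).IsAcyclic := by
  constructor
  · intro h
    exact IsAcyclic.comap (G := G.induce (F : Set V)) (G' := G.within F)
      ⟨Subtype.val, fun {a b} hab => ⟨hab, a.2, b.2⟩⟩ Subtype.val_injective h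
  · intro h v p hp
    have hle : G.within F ≤ G := fun _ _ hab => hab.1
    have hsupp : ∀ x ∈ p.support, x ∈ (F : Set V) := by
      intro x hx
      obtain ⟨e, he, hxe⟩ := (Walk.mem_support_iff_exists_mem_edges_of_not_nil
        (by simpa using hp.not_nil)).1 hx
      induction e with
      | h a b =>
        have := p.adj_of_mem_edges he
        rcases Sym2.mem_iff.1 hxe with rfl | rfl
        · exact this.2.1
        · exact this.2.2
    have hq : (p.mapLe hle).IsCycle := hp.mapLe hle
    have hsupp' : ∀ x ∈ (p.mapLe hle).support, x ∈ (F : Set V) := by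
      simpa using hsupp
    refine h ((p.mapLe hle).induce _ hsupp')
      (Walk.IsCycle.of_map (f := (Embedding.induce _).toHom) ?_)
    rw [Walk.map_induce]
    exact hq

variable [DecidableEq V]

/-- The detour from v through b to a closes a cycle: it avoids the edge va, which would have to be a
bridge in a forest. -/
theorem not_isForest_insert {v a b : V} (hv : v ∉ F) (ha : a ∈ F) (hb : b ∈ F) (hab : a ≠ b)
    (hva : G.Adj v a) (hvb : G.Adj v b) (hr : (G.within F).Reachable a b) :
    ¬ G.IsForest (insert v F) := by
  intro h
  have hbr := isAcyclic_iff_forall_adj_isBridge.1 h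
    (v := v) (w := a) ⟨hva, by simp, by simp [ha]⟩
  rw [isBridge_iff] at hbr
  apply hbr
  have h1 : ((G.within (insert v F)).deleteEdges {s(v, a)}).Adj v b := by
    rw [deleteEdges_adj]
    refine ⟨⟨hvb, by simp, by simp [hb]⟩, ?_⟩
    simp only [Set.mem_singleton_iff, Sym2.eq_iff]
    rintro (⟨-, rfl⟩ | ⟨rfl, rfl⟩)
    · exact hab rfl
    · exact hva.ne rfl
  have h2 : G.within F ≤ (G.within (insert v F)).deleteEdges {s(v, a)} := by
    intro x y hxy
    rw [deleteEdges_adj]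
    refine ⟨within_mono (Finset.subset_insert _ _) hxy, ?_⟩
    simp only [Set.mem_singleton_iff, Sym2.eq_iff]
    rintro (⟨rfl, rfl⟩ | ⟨rfl, rfl⟩)
    · exact hv hxy.2.1
    · exact hv hxy.2.2
  exact h1.reachable.trans (hr.mono h2).symm

/-- A walk inside `insert v F` that does not meet `v` stays inside `F`. -/
theorem mem_within_of_notMem_support {v x y : V} {p : (G.within (insert v F)).Walk x y}
    (hv : v ∉ p.support) : ∀ e ∈ p.edges, e ∈ (G.within F).edgeSet := by
  intro e he
  induction e with
  | h a b =>
    have hab := p.adj_of_mem_edges he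
    have h1 := p.fst_mem_support_of_mem_edges he
    have h2 := p.snd_mem_support_of_mem_edges he
    refine ⟨hab.1, ?_, ?_⟩
    · exact (Finset.mem_insert.1 hab.2.1).resolve_left (fun h => hv (h ▸ h1))
    · exact (Finset.mem_insert.1 hab.2.2).resolve_left (fun h => hv (h ▸ h2))

/-- A new cycle must pass through v. Rotated to start there, it leaves v to one neighbour and
returns from another, and the rest of it joins the two inside F. The hypothesis identifies these
neighbours, so the cycle would use one edge twice. -/
theorem IsForest.insert {v : V} (hF : G.IsForest F)
    (h : ∀ a ∈ F, ∀ b ∈ F, G.Adj v a → G.Adj v b → (G.within F).Reachable a b → a = b) :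
    G.IsForest (insert v F) := by
  by_cases hvF : v ∈ F
  · rwa [Finset.insert_eq_of_mem hvF]
  intro x p hp
  by_cases hv : v ∈ p.support
  · have hc := hp.rotate hv
    revert hc
    generalize p.rotate v hv = c
    intro hc
    cases c with
    | nil => exact hc.not_nil (by simp)
    | cons hva q =>
      rename_i a
      obtain ⟨hq, hne⟩ := (Walk.cons_isCycle_iff _ _).1 hc
      have hrev := hq.reverse
      have hedge : s(v, a) ∉ q.reverse.edges := by simpa using hne
      revert hrev hedge
      generalize q.reverse = r
      intro hrev hedge
      cases r with
      | nil => exact hva.1.ne rfl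
      | cons hvb r =>
        rename_i b
        obtain ⟨-, hvr⟩ := (Walk.cons_isPath_iff _ _).1 hrev
        have ha : a ∈ F := (Finset.mem_insert.1 hva.2.2).resolve_left hva.1.ne'
        have hb : b ∈ F := (Finset.mem_insert.1 hvb.2.2).resolve_left hvb.1.ne'
        have := h b hb a ha hvb.1 hva.1
          ⟨r.transfer _ (mem_within_of_notMem_support hvr)⟩
        subst this
        simp at hedge
  · exact hF _ (hp.transfer (mem_within_of_notMem_support hv))

/-- Otherwise there is a four-cycle, seen here by removing v and inserting it again. This is what
keeps the exchange of vertices in `IsMaxForest.exists_build` injective. -/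
theorem IsForest.eq_of_adj_of_adj {u v a b : V} (hF : G.IsForest F) (hu : u ∈ F) (hv : v ∈ F)
    (ha : a ∈ F) (hb : b ∈ F) (hab : a ≠ b) (hua : G.Adj u a) (hub : G.Adj u b)
    (hva : G.Adj v a) (hvb : G.Adj v b) : u = v := by
  by_contra huv
  have ha' : a ∈ F.erase v := Finset.mem_erase.2 ⟨hva.ne', ha⟩
  have hb' : b ∈ F.erase v := Finset.mem_erase.2 ⟨hvb.ne', hb⟩
  have hu' : u ∈ F.erase v := Finset.mem_erase.2 ⟨huv, hu⟩
  refine not_isForest_insert (Finset.notMem_erase v F) ha' hb' hab hva hvb ?_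
    (by rwa [Finset.insert_erase hv])
  have h1 : (G.within (F.erase v)).Adj a u := ⟨hua.symm, ha', hu'⟩
  have h2 : (G.within (F.erase v)).Adj u b := ⟨hub, hu', hb'⟩
  exact h1.reachable.trans h2.reachable

open Classical in
/-- In a forest, the number of edges between two disjoint parts is at most the number of
vertices. -/
theorem IsForest.sum_card_adj_le {A J : Finset V} (hAJ : Disjoint A J) (hF : G.IsForest (A ∪ J)) :
    ∑ v ∈ J, (A.filter (G.Adj v)).card ≤ A.card + J.card := by
  rcases (A ∪ J).eq_empty_or_nonempty with he | hne
  · obtain ⟨rfl, rfl⟩ := Finset.union_eq_empty.1 he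
    simp
  rw [isForest_iff_isAcyclic_induce] at hF
  have : Nonempty ((A ∪ J : Finset V) : Set V) := ⟨⟨_, hne.choose_spec⟩⟩
  -- Extending the forest to a spanning tree of the complete graph gives the edge bound without
  -- counting components.
  obtain ⟨T, hle, -, hT⟩ :=
    (connected_top (V := ((A ∪ J : Finset V) : Set V))).exists_isTree_le_of_le_of_isAcyclic
      le_top hF
  have hcard := hT.card_edgeFinset
  have hV : Fintype.card ((A ∪ J : Finset V) : Set V) = A.card + J.card := by
    rw [← Finset.card_union_of_disjoint hAJ]
    exact Fintype.card_coe _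
  rw [← Finset.card_sigma, ← hV, ← hcard]
  refine le_trans ?_ (Nat.le_succ _)
  refine le_trans (Finset.card_le_card_of_injOn (t := T.edgeFinset.image (Sym2.map Subtype.val))
    (fun x => s(x.1, x.2)) ?_ ?_) Finset.card_image_le
  · rintro ⟨v, a⟩ hx
    simp only [Finset.coe_sigma, Set.mem_sigma_iff, Finset.mem_coe, Finset.mem_filter] at hx
    obtain ⟨hv, ha, hva⟩ := hx
    refine Finset.mem_image.2 ⟨s(⟨v, by simp [hv]⟩, ⟨a, by simp [ha]⟩), ?_, rfl⟩
    rw [mem_edgeFinset, mem_edgeSet]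
    exact hle hva
  -- Disjointness of the two parts prevents an edge from being counted from both of its ends.
  · rintro ⟨v, a⟩ hx ⟨v', a'⟩ hx' heq
    simp only [Finset.coe_sigma, Set.mem_sigma_iff, Finset.mem_coe, Finset.mem_filter] at hx hx'
    rcases Sym2.eq_iff.1 heq with ⟨h1, h2⟩ | ⟨h1, h2⟩
    · simp only at h1 h2
      subst h1 h2
      rfl
    · simp only at h1 h2
      subst h1 h2
      exact absurd hx.1 (Finset.disjoint_left.1 hAJ hx'.2.1)

theorem isFVS_iff_isForest_compl [Fintype V] (S : Finset V) : G.IsFVS S ↔ G.IsForest Sᶜ := by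
  rw [isForest_iff_isAcyclic_induce, IsFVS, Finset.coe_compl]

/-- `F` is an inclusion-maximal induced forest. -/
def IsMaxForest (G : SimpleGraph V) (F : Finset V) : Prop :=
  G.IsForest F ∧ ∀ v ∉ F, ¬ G.IsForest (insert v F)

/-- Complementation. Subsets of forests are forests, so maximality may be tested by adding single
vertices. -/
theorem maxMinFVS_iff [Fintype V] (k : ℕ) :
    MaxMinFVS G k ↔ ∃ F : Finset V, G.IsMaxForest F ∧ k + F.card ≤ Fintype.card V := by
  constructor
  · rintro ⟨S, hS, hk⟩
    refine ⟨Sᶜ, ⟨(isFVS_iff_isForest_compl S).1 hS.prop, fun v hv hf => ?_⟩, ?_⟩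
    · have hv' : v ∈ S := by simpa using hv
      have h1 : G.IsFVS (S.erase v) := by
        rw [isFVS_iff_isForest_compl, Finset.compl_erase]
        exact hf
      exact Finset.notMem_erase v S (hS.le_of_le h1 (Finset.erase_subset v S) hv')
    · have := Finset.card_add_card_compl S
      omega
  · rintro ⟨F, ⟨hF, hmax⟩, hk⟩
    refine ⟨Fᶜ, ⟨?_, fun S hS hSF => ?_⟩, ?_⟩
    · rw [isFVS_iff_isForest_compl, compl_compl]
      exact hF
    · intro v hv
      by_contra hvS
      refine hmax v (by simpa using hv) (((isFVS_iff_isForest_compl S).1 hS).mono ?_)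
      intro x hx
      rcases Finset.mem_insert.1 hx with rfl | hx
      · simpa using hvS
      · simp only [Finset.mem_compl]
        intro hxS
        exact (Finset.mem_compl.1 (hSF hxS)) hx
    · have := Finset.card_add_card_compl F
      omega

end SimpleGraph

/-! ### Describing a maximal forest by a short list of instructions. -/

namespace SimpleGraph

variable {V : Type*} [DecidableEq V] (G : SimpleGraph V)

open Classical in
/-- Adds `v` to the forest `F` if the result is a forest. -/
noncomputable def tryAdd (F : Finset V) (v : V) : Finset V :=
  if G.IsForest (insert v F) then insert v F else F

/-- The instructions by which a forest is built. -/
inductive Instr (V : Type*)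
  | nop
  | flush
  | add (v : V)
  | mark (v : V)

/-- All vertices named by the instruction lie in `C`. -/
def Instr.Over (C : Finset V) : Instr V → Prop
  | .nop => True
  | .flush => True
  | .add v => v ∈ C
  | .mark v => v ∈ C

/-- The vertices outside `C` which are adjacent to all marked vertices and, among the vertices
of `F ∩ C`, to no others. -/
def Fits (C F R : Finset V) (v : V) : Prop :=
  v ∉ C ∧ ∀ x ∈ C, (x ∈ R → G.Adj v x) ∧ (G.Adj v x → x ∈ F → x ∈ R)

/-- The effect of an instruction on the current forest and the set of marked vertices. -/
noncomputable def Instr.run (pick : (V → Prop) → Option V) (C : Finset V) :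
    Finset V × Finset V → Instr V → Finset V × Finset V
  | σ, .nop => σ
  | σ, .flush => ((pick (G.Fits C σ.1 σ.2)).elim σ.1 (G.tryAdd σ.1), ∅)
  | σ, .add v => (G.tryAdd σ.1 v, σ.2)
  | σ, .mark v => (σ.1, insert v σ.2)

open Classical in
/-- Tries a vertex outside `C` with at most one neighbour in `F ∩ C`. -/
noncomputable def tryLeaf (C F : Finset V) (v : V) : Finset V :=
  if v ∉ C ∧ (C.filter fun x => x ∈ F ∧ G.Adj v x).card ≤ 1 then G.tryAdd F v else F

/-- Completes a forest greedily, leaves outside `C` first. -/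
noncomputable def complete (C : Finset V) (l : List V) (F : Finset V) : Finset V :=
  l.foldl G.tryAdd (l.foldl (G.tryLeaf C) F)

/-- The forest that results from a list of instructions. -/
noncomputable def build (pick : (V → Prop) → Option V) (C : Finset V) (l : List V)
    (is : List (Instr V)) : Finset V :=
  G.complete C l (is.foldl (Instr.run G pick C) (∅, ∅)).1

variable {G} {F T C : Finset V}

theorem subset_tryAdd (v : V) : F ⊆ G.tryAdd F v := by
  unfold tryAdd
  split_ifs
  · exact Finset.subset_insert _ _
  · exact subset_rfl

theorem IsForest.tryAdd (h : G.IsForest F) (v : V) : G.IsForest (G.tryAdd F v) := by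
  unfold SimpleGraph.tryAdd
  split_ifs with h'
  · exact h'
  · exact h

theorem tryAdd_of_isForest {v : V} (h : G.IsForest (insert v F)) : G.tryAdd F v = insert v F :=
  if_pos h

theorem tryAdd_of_subset {v : V} (hT : G.IsForest T) (hF : F ⊆ T) (hv : v ∈ T) :
    G.tryAdd F v = insert v F :=
  tryAdd_of_isForest (hT.mono (Finset.insert_subset hv hF))

theorem IsMaxForest.tryAdd_eq (h : G.IsMaxForest F) (v : V) : G.tryAdd F v = F := by
  by_cases hv : v ∈ F
  · rw [tryAdd_of_isForest (by rw [Finset.insert_eq_of_mem hv]; exact h.1),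
      Finset.insert_eq_of_mem hv]
  · exact if_neg (h.2 v hv)

theorem IsMaxForest.foldl_tryAdd_eq (h : G.IsMaxForest F) (l : List V) :
    l.foldl G.tryAdd F = F := by
  induction l with
  | nil => rfl
  | cons v l ih => rw [List.foldl_cons, h.tryAdd_eq, ih]

theorem subset_foldl_tryAdd (l : List V) (F : Finset V) : F ⊆ l.foldl G.tryAdd F := by
  induction l generalizing F with
  | nil => exact subset_rfl
  | cons v l ih => exact (subset_tryAdd v).trans (ih _)

theorem IsForest.foldl_tryAdd (h : G.IsForest F) (l : List V) :
    G.IsForest (l.foldl G.tryAdd F) := by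
  induction l generalizing F with
  | nil => exact h
  | cons v l ih => exact ih (h.tryAdd v)

/-- One pass suffices: a vertex rejected by a smaller forest is rejected by every larger one. -/
theorem not_isForest_insert_foldl_tryAdd {l : List V} {v : V} (hv : v ∈ l)
    (hn : v ∉ l.foldl G.tryAdd F) : ¬ G.IsForest (insert v (l.foldl G.tryAdd F)) := by
  induction l generalizing F with
  | nil => simp at hv
  | cons u l ih =>
    rcases List.mem_cons.1 hv with rfl | hv
    · intro h
      have hsub := subset_foldl_tryAdd (G := G) l (G.tryAdd F v)
      have h1 : G.IsForest (insert v F) :=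
        h.mono (Finset.insert_subset_insert _ ((subset_tryAdd v).trans hsub))
      apply hn
      apply hsub
      rw [tryAdd_of_isForest h1]
      exact Finset.mem_insert_self _ _
    · exact ih hv hn

theorem IsForest.foldl_tryLeaf (h : G.IsForest F) (l : List V) :
    G.IsForest (l.foldl (G.tryLeaf C) F) := by
  induction l generalizing F with
  | nil => exact h
  | cons v l ih =>
    refine ih ?_
    unfold tryLeaf
    split_ifs
    · exact h.tryAdd v
    · exact h

theorem IsForest.run {pick : (V → Prop) → Option V} {σ : Finset V × Finset V}
    (h : G.IsForest σ.1) (i : Instr V) : G.IsForest (Instr.run G pick C σ i).1 := by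
  cases i with
  | nop => exact h
  | flush =>
    simp only [Instr.run]
    cases pick (G.Fits C σ.1 σ.2) with
    | none => exact h
    | some v => exact h.tryAdd v
  | add v => exact h.tryAdd v
  | mark v => exact h

theorem IsForest.foldl_run {pick : (V → Prop) → Option V} {σ : Finset V × Finset V}
    (h : G.IsForest σ.1) (is : List (Instr V)) :
    G.IsForest (is.foldl (Instr.run G pick C) σ).1 := by
  induction is generalizing σ with
  | nil => exact h
  | cons i is ih => exact ih (h.run i)

/-- Soundness of guessing: the final greedy pass makes the result maximal whatever the instructions
and the choice function were. -/
theorem isMaxForest_build (pick : (V → Prop) → Option V) {l : List V} (hl : ∀ v, v ∈ l)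
    (is : List (Instr V)) : G.IsMaxForest (G.build pick C l is) :=
  ⟨((isForest_empty.foldl_run is).foldl_tryLeaf l).foldl_tryAdd l,
    fun v hv => not_isForest_insert_foldl_tryAdd (hl v) hv⟩

theorem IsMaxForest.exists_witnesses (h : G.IsMaxForest F) {v : V} (hv : v ∉ F) :
    ∃ a ∈ F, ∃ b ∈ F, a ≠ b ∧ G.Adj v a ∧ G.Adj v b ∧ (G.within F).Reachable a b := by
  by_contra! hc
  refine h.2 v hv (h.1.insert fun a ha b hb hva hvb hr => ?_)
  by_contra hab
  exact hc a ha b hb hab hva hvb hr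

/-- Every maximal forest is matched by a forest of the same size whose vertices outside the
vertex cover `C` are recovered from few instructions. -/
theorem IsMaxForest.exists_build {pick : (V → Prop) → Option V}
    (hsome : ∀ P v, pick P = some v → P v) (hnone : ∀ P, pick P = none → ∀ v, ¬ P v)
    (hC : ∀ u v, G.Adj u v → u ∈ C ∨ v ∈ C) {l : List V} (hl : ∀ v, v ∈ l)
    (hF : G.IsMaxForest F) :
    ∃ is : List (Instr V), (∀ i ∈ is, i.Over C) ∧ is.length ≤ 4 * C.card ∧
      (G.build pick C l is).card = F.card := by
  classical
  -- The two witnesses are made total in v so that they can be chosen as functions; their values on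
  -- F are irrelevant.
  have hwit : ∀ v, ∃ a b, v ∉ F → a ∈ F ∧ b ∈ F ∧ a ≠ b ∧ G.Adj v a ∧ G.Adj v b ∧
      (G.within F).Reachable a b := by
    intro v
    by_cases hv : v ∈ F
    · exact ⟨v, v, fun h => absurd hv h⟩
    · obtain ⟨a, ha, b, hb, h⟩ := hF.exists_witnesses hv
      exact ⟨a, b, fun _ => ⟨ha, hb, h⟩⟩
  choose P Q hPQ using hwit
  -- `W v` collects the vertices of C \ F that rely on v as a witness. The marks `R v` are what a
  -- replacement of v must respect: `A v` keeps the forest isomorphic, `W v` keeps it maximal.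
  set A : V → Finset V := fun v => (F ∩ C).filter (G.Adj v) with hA
  set J : Finset V := (F \ C).filter fun v => 2 ≤ (A v).card with hJ
  set W : V → Finset V := fun v => (C \ F).filter fun s => P s = v ∨ Q s = v with hW
  set R : V → Finset V := fun v => A v ∪ W v with hR
  have memA : ∀ v x, x ∈ A v ↔ (x ∈ F ∧ x ∈ C) ∧ G.Adj v x := fun v x => by simp [hA]
  have memJ : ∀ v, v ∈ J ↔ (v ∈ F ∧ v ∉ C) ∧ 2 ≤ (A v).card := fun v => by simp [hJ]
  have memW : ∀ v x, x ∈ W v ↔ (x ∈ C ∧ x ∉ F) ∧ (P x = v ∨ Q x = v) := fun v x => by simp [hW]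
  have memR : ∀ v x, x ∈ R v ↔ x ∈ A v ∨ x ∈ W v := fun v x => by simp [hR]
  have hfits : ∀ v ∈ J, G.Fits C (F ∩ C) (R v) v := by
    intro v hv
    rw [memJ] at hv
    refine ⟨hv.1.2, fun x hx => ⟨fun hxR => ?_, fun hvx hxF => ?_⟩⟩
    · rcases (memR v x).1 hxR with h | h
      · exact ((memA v x).1 h).2
      · obtain ⟨⟨-, hxF⟩, h | h⟩ := (memW v x).1 h
        · exact h ▸ (hPQ x hxF).2.2.2.1.symm
        · exact h ▸ (hPQ x hxF).2.2.2.2.1.symm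
    · exact (memR v x).2 (Or.inl ((memA v x).2 ⟨Finset.mem_inter.1 hxF, hvx⟩))
  -- Each vertex of J moves to the vertex that `pick` returns for its marks; since v itself fits,
  -- `pick` never fails and the default is not used.
  set φ : V → V := fun v => if v ∈ J then (pick (G.Fits C (F ∩ C) (R v))).getD v else v with hφ
  have hpick : ∀ v ∈ J, pick (G.Fits C (F ∩ C) (R v)) = some (φ v) := by
    intro v hv
    cases h : pick (G.Fits C (F ∩ C) (R v)) with
    | none => exact absurd (hfits v hv) (hnone _ h v)
    | some u => simp [hφ, hv, h]
  have φfits : ∀ v ∈ J, G.Fits C (F ∩ C) (R v) (φ v) := fun v hv => hsome _ _ (hpick v hv)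
  have φid : ∀ v, v ∉ J → φ v = v := fun v hv => by simp [hφ, hv]
  have φC : ∀ v, v ∈ C → φ v = v := fun v hv => φid v (fun h => ((memJ v).1 h).1.2 hv)
  have φnC : ∀ v, v ∉ C → φ v ∉ C := by
    intro v hv
    by_cases hvJ : v ∈ J
    · exact (φfits v hvJ).1
    · rwa [φid v hvJ]
  have φadj : ∀ v x, v ∉ C → x ∈ F → x ∈ C → (G.Adj (φ v) x ↔ G.Adj v x) := by
    intro v x hv hxF hxC
    by_cases hvJ : v ∈ J
    · have h1 := (φfits v hvJ).2 x hxC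
      have h2 := (hfits v hvJ).2 x hxC
      have hx : x ∈ F ∩ C := Finset.mem_inter.2 ⟨hxF, hxC⟩
      exact ⟨fun h => h2.1 (h1.2 h hx), fun h => h1.1 (h2.2 h hx)⟩
    · rw [φid v hvJ]
  have φA : ∀ v, v ∉ C → A (φ v) = A v := by
    intro v hv
    ext x
    rw [memA, memA]
    exact and_congr_right fun h => φadj v x hv h.1 h.2
  -- Outside C, vertices with equal images have the same neighbours in F ∩ C. For vertices of J
  -- these number at least two, so distinct ones would span a four-cycle in F.
  have φinj : ∀ u ∈ F, ∀ v ∈ F, φ u = φ v → u = v := by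
    intro u hu v hv huv
    by_cases huC : u ∈ C
    · by_cases hvC : v ∈ C
      · rwa [φC u huC, φC v hvC] at huv
      · exact absurd (huv ▸ (φC u huC).symm ▸ huC) (φnC v hvC)
    · have hvC : v ∉ C := fun hvC => φnC u huC (huv ▸ (φC v hvC).symm ▸ hvC)
      have hAA : A u = A v := by rw [← φA u huC, ← φA v hvC, huv]
      by_cases huJ : u ∈ J
      · obtain ⟨a, ha, b, hb, hab⟩ := Finset.one_lt_card.1 ((memJ u).1 huJ).2
        have ha' := (memA v a).1 (hAA ▸ ha)
        have hb' := (memA v b).1 (hAA ▸ hb)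
        exact hF.1.eq_of_adj_of_adj hu hv ha'.1.1 hb'.1.1 hab ((memA u a).1 ha).2
          ((memA u b).1 hb).2 ha'.2 hb'.2
      · have hvJ : v ∉ J := fun h => huJ ((memJ u).2 ⟨⟨hu, huC⟩, hAA ▸ ((memJ v).1 h).2⟩)
        rwa [φid u huJ, φid v hvJ] at huv
  have φiso : ∀ u ∈ F, ∀ v ∈ F, (G.Adj (φ u) (φ v) ↔ G.Adj u v) := by
    intro u hu v hv
    by_cases huC : u ∈ C
    · rw [φC u huC]
      by_cases hvC : v ∈ C
      · rw [φC v hvC]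
      · rw [G.adj_comm, φadj v u hvC hu huC, G.adj_comm]
    · by_cases hvC : v ∈ C
      · rw [φC v hvC, φadj u v huC hv hvC]
      · exact iff_of_false (fun h => (hC _ _ h).elim (φnC u huC) (φnC v hvC))
          (fun h => (hC _ _ h).elim huC hvC)
  set F' := F.image φ with hF'
  have memF' : ∀ v ∈ F, φ v ∈ F' := fun v hv => Finset.mem_image_of_mem _ hv
  have hforest : G.IsForest F' := by
    have h0 := hF.1
    rw [isForest_iff_isAcyclic_induce] at h0 ⊢
    have hex : ∀ y : (F' : Set V), ∃ x : (F : Set V), φ x = y := by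
      rintro ⟨y, hy⟩
      obtain ⟨x, hx, rfl⟩ := Finset.mem_image.1 hy
      exact ⟨⟨x, hx⟩, rfl⟩
    choose ψ hψ using hex
    refine IsAcyclic.comap (G := G.induce (F' : Set V)) (G' := G.induce (F : Set V))
      ⟨ψ, fun {a b} hab => ?_⟩ ?_ h0
    · have : G.Adj (a : V) b := hab
      rw [← hψ a, ← hψ b] at this
      exact (φiso _ (ψ a).2 _ (ψ b).2).1 this
    · intro a b hab
      apply Subtype.ext
      have hab' : ψ a = ψ b := hab
      rw [← hψ a, ← hψ b, hab']
  have hreach : ∀ a b, (G.within F).Reachable a b → (G.within F').Reachable (φ a) (φ b) :=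
    fun a b h => h.map (G := G.within F) (G' := G.within F') ⟨φ, fun {x y} hxy =>
      ⟨(φiso x hxy.2.1 y hxy.2.2).2 hxy.1, memF' x hxy.2.1, memF' y hxy.2.2⟩⟩
  -- Three kinds of vertices v outside F'. If v is in C, its witnesses are moved along and stay
  -- adjacent to v because of the marks `W`. If v is in F \ C, it was replaced, and it closes a
  -- four-cycle with its replacement. If v is in neither C nor F, its witnesses lie in C and do not
  -- move.
  have hmax : G.IsMaxForest F' := by
    refine ⟨hforest, fun v hv => ?_⟩
    by_cases hvC : v ∈ C
    · have hvF : v ∉ F := fun h => hv (φC v hvC ▸ memF' v h)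
      obtain ⟨ha, hb, hab, hva, hvb, hr⟩ := hPQ v hvF
      have key : ∀ a ∈ F, G.Adj v a → (P v = a ∨ Q v = a) → G.Adj v (φ a) := by
        intro a ha hva h
        by_cases haJ : a ∈ J
        · exact (((φfits a haJ).2 v hvC).1
            ((memR a v).2 (Or.inr ((memW a v).2 ⟨⟨hvC, hvF⟩, h⟩)))).symm
        · rwa [φid a haJ]
      exact not_isForest_insert hv (memF' _ ha) (memF' _ hb) (fun h => hab (φinj _ ha _ hb h))
        (key _ ha hva (Or.inl rfl)) (key _ hb hvb (Or.inr rfl)) (hreach _ _ hr)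
    · by_cases hvF : v ∈ F
      · have hvJ : v ∈ J := by
          by_contra h
          exact hv (φid v h ▸ memF' v hvF)
        obtain ⟨a, ha, b, hb, hab⟩ := Finset.one_lt_card.1 ((memJ v).1 hvJ).2
        rw [memA] at ha hb
        have ha' : a ∈ F' := φC a ha.1.2 ▸ memF' a ha.1.1
        have hb' : b ∈ F' := φC b hb.1.2 ▸ memF' b hb.1.1
        have h1 : (G.within F').Adj (φ v) a :=
          ⟨(φadj v a hvC ha.1.1 ha.1.2).2 ha.2, memF' v hvF, ha'⟩
        have h2 : (G.within F').Adj (φ v) b :=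
          ⟨(φadj v b hvC hb.1.1 hb.1.2).2 hb.2, memF' v hvF, hb'⟩
        exact not_isForest_insert hv ha' hb' hab ha.2 hb.2 (h1.symm.reachable.trans h2.reachable)
      · obtain ⟨ha, hb, hab, hva, hvb, hr⟩ := hPQ v hvF
        have ha' := φC _ ((hC _ _ hva).resolve_left hvC)
        have hb' := φC _ ((hC _ _ hvb).resolve_left hvC)
        have hr' := hreach _ _ hr
        rw [ha', hb'] at hr'
        exact not_isForest_insert hv (ha' ▸ memF' _ ha) (hb' ▸ memF' _ hb) hab hva hvb hr'
  have hF'C : ∀ x, x ∈ F' → x ∈ C → x ∈ F := by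
    intro x hx hxC
    obtain ⟨y, hy, rfl⟩ := Finset.mem_image.1 hx
    by_cases hyC : y ∈ C
    · rwa [φC y hyC]
    · exact absurd hxC (φnC y hyC)
  -- Every intermediate forest meets C in F ∩ C, so `Fits` gives the same answer at each flush as at
  -- the beginning.
  have hinter : ∀ E, F ∩ C ⊆ E → E ⊆ F' → ∀ x ∈ C, (x ∈ E ↔ x ∈ F ∩ C) := fun E h1 h2 x hx =>
    ⟨fun h => Finset.mem_inter.2 ⟨hF'C x (h2 h) hx, hx⟩, fun h => h1 h⟩
  have hsub0 : F ∩ C ⊆ F' := fun x hx => by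
    obtain ⟨h1, h2⟩ := Finset.mem_inter.1 hx
    exact φC x h2 ▸ memF' x h1
  -- Every vertex offered lies in the forest F', so no `tryAdd` is refused.
  have hrunAdd : ∀ (L : List V) (E : Finset V), E ⊆ F' → (∀ x ∈ L, x ∈ F') →
      (L.map Instr.add).foldl (Instr.run G pick C) (E, ∅) = (E ∪ L.toFinset, ∅) := by
    intro L
    induction L with
    | nil => intro E _ _; simp
    | cons x L ih =>
      intro E hE hL
      have hx := hL x (by simp)
      rw [List.map_cons, List.foldl_cons, Instr.run, tryAdd_of_subset hforest hE hx,
        ih _ (Finset.insert_subset hx hE) (fun y hy => hL y (by simp [hy]))]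
      congr 1
      ext y
      simp
  have hrunMark : ∀ (L : List V) (E S : Finset V),
      (L.map Instr.mark).foldl (Instr.run G pick C) (E, S) = (E, S ∪ L.toFinset) := by
    intro L
    induction L with
    | nil => intro E S; simp
    | cons x L ih =>
      intro E S
      rw [List.map_cons, List.foldl_cons, Instr.run, ih]
      congr 1
      ext y
      simp
  have hrunBlock : ∀ (L : List V) (E : Finset V), F ∩ C ⊆ E → E ⊆ F' → (∀ x ∈ L, x ∈ J) →
      (L.flatMap fun v => (R v).toList.map Instr.mark ++ [Instr.flush]).foldl
        (Instr.run G pick C) (E, ∅) = (E ∪ (L.map φ).toFinset, ∅) := by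
    intro L
    induction L with
    | nil => intro E _ _ _; simp
    | cons v L ih =>
      intro E h1 h2 hL
      have hv := hL v (by simp)
      have hφv := memF' v ((memJ v).1 hv).1.1
      have hE : G.Fits C E (R v) = G.Fits C (F ∩ C) (R v) := by
        funext u
        apply propext
        refine and_congr_right fun _ => forall_congr' fun x => forall_congr' fun hx => ?_
        rw [hinter E h1 h2 x hx]
      rw [List.flatMap_cons, List.foldl_append, List.foldl_append, hrunMark, List.foldl_cons,
        List.foldl_nil, Instr.run]
      simp only [Finset.empty_union, Finset.toList_toFinset, hE, hpick v hv, Option.elim_some]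
      rw [tryAdd_of_subset hforest h2 hφv,
        ih _ (h1.trans (Finset.subset_insert _ _)) (Finset.insert_subset hφv h2)
          (fun y hy => hL y (by simp [hy]))]
      congr 1
      ext y
      simp
  -- A vertex outside C with at most one neighbour in F ∩ C belongs to F, as both witnesses against
  -- it would lie in C. It is not in J, so it is fixed by φ and belongs to F'.
  have hleaf : ∀ (L : List V) (E : Finset V), F ∩ C ⊆ E → E ⊆ F' →
      L.foldl (G.tryLeaf C) E ⊆ F' ∧ E ⊆ L.foldl (G.tryLeaf C) E ∧
      ∀ v ∈ L, v ∈ F → v ∉ C → v ∉ J → v ∈ L.foldl (G.tryLeaf C) E := by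
    intro L
    induction L with
    | nil => intro E h1 h2; exact ⟨h2, subset_rfl, by simp⟩
    | cons v L ih =>
      intro E h1 h2
      have hfil : (C.filter fun x => x ∈ E ∧ G.Adj v x) = A v := by
        ext x
        rw [memA, Finset.mem_filter]
        constructor
        · rintro ⟨hx, hxE, hadj⟩
          exact ⟨⟨hF'C x (h2 hxE) hx, hx⟩, hadj⟩
        · rintro ⟨⟨hxF, hxC⟩, hadj⟩
          exact ⟨hxC, h1 (Finset.mem_inter.2 ⟨hxF, hxC⟩), hadj⟩
      rw [List.foldl_cons]
      by_cases hc : v ∉ C ∧ (A v).card ≤ 1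
      · have hvF : v ∈ F := by
          by_contra hvF
          obtain ⟨ha, hb, hab, hva, hvb, -⟩ := hPQ v hvF
          have := Finset.one_lt_card.2 ⟨P v,
            (memA v _).2 ⟨⟨ha, (hC _ _ hva).resolve_left hc.1⟩, hva⟩, Q v,
            (memA v _).2 ⟨⟨hb, (hC _ _ hvb).resolve_left hc.1⟩, hvb⟩, hab⟩
          omega
        have hvJ : v ∉ J := fun h => by have := ((memJ v).1 h).2; omega
        have hvF' : v ∈ F' := φid v hvJ ▸ memF' v hvF
        have hstep : G.tryLeaf C E v = insert v E := by
          rw [tryLeaf, hfil, if_pos hc, tryAdd_of_subset hforest h2 hvF']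
        rw [hstep]
        obtain ⟨i1, i2, i3⟩ := ih (insert v E) (h1.trans (Finset.subset_insert _ _))
          (Finset.insert_subset hvF' h2)
        refine ⟨i1, (Finset.subset_insert _ _).trans i2, fun u hu huF huC huJ => ?_⟩
        rcases List.mem_cons.1 hu with rfl | hu
        · exact i2 (Finset.mem_insert_self _ _)
        · exact i3 u hu huF huC huJ
      · have hstep : G.tryLeaf C E v = E := by
          rw [tryLeaf, hfil, if_neg hc]
        rw [hstep]
        obtain ⟨i1, i2, i3⟩ := ih E h1 h2
        refine ⟨i1, i2, fun u hu huF huC huJ => ?_⟩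
        rcases List.mem_cons.1 hu with rfl | hu
        · exact absurd ⟨huC, by
            by_contra hlt
            exact huJ ((memJ u).2 ⟨⟨huF, huC⟩, by omega⟩)⟩ hc
        · exact i3 u hu huF huC huJ
  refine ⟨(F ∩ C).toList.map Instr.add ++
    J.toList.flatMap (fun v => (R v).toList.map Instr.mark ++ [Instr.flush]), ?_, ?_, ?_⟩
  · intro i hi
    simp only [List.mem_append, List.mem_map, Finset.mem_toList, List.mem_flatMap,
      List.mem_singleton] at hi
    rcases hi with ⟨x, hx, rfl⟩ | ⟨v, hv, ⟨x, hx, rfl⟩ | rfl⟩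
    · exact (Finset.mem_inter.1 hx).2
    · rcases (memR v x).1 hx with h | h
      · exact ((memA v x).1 h).1.2
      · exact ((memW v x).1 h).1.1
    · trivial
  · have hlen : (J.toList.flatMap
        (fun v => (R v).toList.map Instr.mark ++ [Instr.flush])).length =
        ∑ v ∈ J, ((R v).card + 1) := by
      rw [List.length_flatMap, ← Finset.sum_map_toList]
      simp
    rw [List.length_append, hlen, List.length_map, Finset.length_toList]
    -- From `h2` and `h3`, |J| ≤ |F ∩ C|. The length is at most |F ∩ C| + (|F ∩ C| + |J|) + 2|C \ F|
    -- + |J|, where the last |J| counts the flushes, and hence at most 4|C|.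
    have h1 : ∑ v ∈ J, (R v).card ≤ ∑ v ∈ J, (A v).card + ∑ v ∈ J, (W v).card := by
      rw [← Finset.sum_add_distrib]
      exact Finset.sum_le_sum fun v _ => Finset.card_union_le _ _
    have h2 : ∑ v ∈ J, (A v).card ≤ (F ∩ C).card + J.card := by
      refine IsForest.sum_card_adj_le ?_ (hF.1.mono ?_)
      · rw [Finset.disjoint_left]
        exact fun x hx hxJ => ((memJ x).1 hxJ).1.2 (Finset.mem_inter.1 hx).2
      · refine Finset.union_subset Finset.inter_subset_left fun x hx => ((memJ x).1 hx).1.1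
    have h3 : J.card * 2 ≤ ∑ v ∈ J, (A v).card := by
      rw [← smul_eq_mul]
      exact Finset.card_nsmul_le_sum _ _ _ fun v hv => ((memJ v).1 hv).2
    have h4 : ∑ v ∈ J, (W v).card ≤ 2 * (C \ F).card := by
      have e : ∀ f : V → V, ∑ v ∈ J, ((C \ F).filter fun s => f s = v).card ≤ (C \ F).card := by
        intro f
        rw [← Finset.card_biUnion]
        · exact Finset.card_le_card (Finset.biUnion_subset.2 fun v _ => Finset.filter_subset _ _)
        · intro u _ v _ huv
          rw [Function.onFun, Finset.disjoint_left]
          intro x hx hx'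
          exact huv ((Finset.mem_filter.1 hx).2.symm.trans (Finset.mem_filter.1 hx').2)
      have h5 : ∑ v ∈ J, (W v).card ≤ ∑ v ∈ J, (((C \ F).filter fun s => P s = v).card +
          ((C \ F).filter fun s => Q s = v).card) := by
        refine Finset.sum_le_sum fun v _ => ?_
        simp only [hW, Finset.filter_or]
        exact Finset.card_union_le _ _
      rw [Finset.sum_add_distrib] at h5
      have := e P
      have := e Q
      omega
    have h6 : (F ∩ C).card + (C \ F).card = C.card := by
      rw [Finset.inter_comm]
      exact Finset.card_inter_add_card_sdiff C F
    rw [Finset.sum_add_distrib, Finset.sum_const, smul_eq_mul, mul_one]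
    omega
  · have hrun : (((F ∩ C).toList.map Instr.add ++
        J.toList.flatMap (fun v => (R v).toList.map Instr.mark ++ [Instr.flush])).foldl
        (Instr.run G pick C) (∅, ∅)).1 = (F ∩ C) ∪ J.image φ := by
      rw [List.foldl_append, hrunAdd _ _ (Finset.empty_subset _)
        (fun x hx => hsub0 (Finset.mem_toList.1 hx)), Finset.empty_union, Finset.toList_toFinset,
        hrunBlock _ _ subset_rfl hsub0 (fun x hx => Finset.mem_toList.1 hx)]
      ext y
      simp
    have hstart : (F ∩ C) ∪ J.image φ ⊆ F' :=
      Finset.union_subset hsub0 (Finset.image_subset_image fun x hx => ((memJ x).1 hx).1.1)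
    obtain ⟨i1, i2, i3⟩ := hleaf l _ Finset.subset_union_left hstart
    have heq : l.foldl (G.tryLeaf C) ((F ∩ C) ∪ J.image φ) = F' := by
      refine subset_antisymm i1 fun y hy => ?_
      obtain ⟨x, hx, rfl⟩ := Finset.mem_image.1 hy
      by_cases hxC : x ∈ C
      · rw [φC x hxC]
        exact i2 (Finset.mem_union_left _ (Finset.mem_inter.2 ⟨hx, hxC⟩))
      · by_cases hxJ : x ∈ J
        · exact i2 (Finset.mem_union_right _ (Finset.mem_image_of_mem _ hxJ))
        · rw [φid x hxJ]
          exact i3 x (hl x) hx hxC hxJ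
    -- F' is already maximal, so the last greedy pass adds nothing.
    rw [build, hrun, complete, heq, hmax.foldl_tryAdd_eq]
    exact Finset.card_image_of_injOn fun u hu v hv => φinj u hu v hv

theorem maxMinFVS_iff_exists_build [Fintype V] {pick : (V → Prop) → Option V}
    (hsome : ∀ P v, pick P = some v → P v) (hnone : ∀ P, pick P = none → ∀ v, ¬ P v)
    (hC : ∀ u v, G.Adj u v → u ∈ C ∨ v ∈ C) {l : List V} (hl : ∀ v, v ∈ l) (k : ℕ) :
    MaxMinFVS G k ↔ ∃ is : List (Instr V), (∀ i ∈ is, i.Over C) ∧ is.length ≤ 4 * C.card ∧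
      k + (G.build pick C l is).card ≤ Fintype.card V := by
  rw [maxMinFVS_iff]
  constructor
  · rintro ⟨F, hF, hk⟩
    obtain ⟨is, h1, h2, h3⟩ := hF.exists_build hsome hnone hC hl
    exact ⟨is, h1, h2, h3.symm ▸ hk⟩
  · rintro ⟨is, -, -, hk⟩
    exact ⟨_, isMaxForest_build pick hl is, hk⟩

end SimpleGraph

/-! ### Component labels and the program that extends a forest by a vertex. -/

namespace RAM

open SimpleGraph

variable {n : ℕ} {G : SimpleGraph (Fin n)}

/-- `lab` labels the components of the forest induced by `F`. -/
structure Labels (G : SimpleGraph (Fin n)) (F : Finset (Fin n)) (lab : ℕ → ℕ) : Prop where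
  forest : G.IsForest F
  mem : ∀ v : Fin n, lab v ≠ 0 ↔ v ∈ F
  reach : ∀ u ∈ F, ∀ v ∈ F, (lab u = lab v ↔ (G.within F).Reachable u v)
  root : ∀ u ∈ F, ∃ w ∈ F, lab u = (w : ℕ) + 1

theorem Labels.empty {lab : ℕ → ℕ} (h : ∀ v < n, lab v = 0) : Labels G ∅ lab where
  forest := isForest_empty
  mem v := by simp [h v v.2]
  reach := by simp
  root := by simp

theorem Labels.le {F : Finset (Fin n)} {lab : ℕ → ℕ} (h : Labels G F lab) (v : Fin n) :
    lab v ≤ n := by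
  by_cases hv : v ∈ F
  · obtain ⟨w, -, hw⟩ := h.root v hv
    omega
  · have : lab v = 0 := by
      by_contra h0
      exact hv ((h.mem v).1 h0)
    omega

/-- The neighbours of `v` in the forest have distinct labels. -/
def DistinctNbrs (G : SimpleGraph (Fin n)) (F : Finset (Fin n)) (lab : ℕ → ℕ) (v : Fin n) : Prop :=
  ∀ a ∈ F, ∀ b ∈ F, G.Adj v a → G.Adj v b → lab a = lab b → a = b

/-- This turns the search for a cycle into a comparison of labels among the neighbours of v. -/
theorem Labels.isForest_insert_iff {F : Finset (Fin n)} {lab : ℕ → ℕ} (h : Labels G F lab)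
    {v : Fin n} (hv : v ∉ F) : G.IsForest (insert v F) ↔ DistinctNbrs G F lab v := by
  constructor
  · intro hf a ha b hb hva hvb hab
    by_contra hne
    exact not_isForest_insert hv ha hb hne hva hvb ((h.reach a ha b hb).1 hab) hf
  · intro hd
    exact h.forest.insert fun a ha b hb hva hvb hr =>
      hd a ha b hb hva hvb ((h.reach a ha b hb).2 hr)

/-- Inserting v fuses the components of its neighbours. Labels stay constant along every edge of the
larger forest, and whatever carries the label v + 1 is connected to v. -/
theorem Labels.insert_vertex {F : Finset (Fin n)} {lab lab' : ℕ → ℕ} (h : Labels G F lab) {v : Fin n}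
    (hv : v ∉ F) (hd : DistinctNbrs G F lab v) (hself : lab' v = v + 1)
    (hjoin : ∀ u : Fin n, u ≠ v → (∃ a ∈ F, G.Adj v a ∧ lab a = lab u) → lab' u = v + 1)
    (hkeep : ∀ u : Fin n, u ≠ v → (¬ ∃ a ∈ F, G.Adj v a ∧ lab a = lab u) → lab' u = lab u) :
    Labels G (insert v F) lab' := by
  -- Labels have the form w + 1 with w in F, so v + 1 is unused as long as v is not in F.
  have fresh : ∀ u ∈ F, lab u ≠ v + 1 := by
    intro u hu heq
    obtain ⟨w, hw, hw'⟩ := h.root u hu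
    have : w = v := Fin.ext (by omega)
    exact hv (this ▸ hw)
  have ne : ∀ u ∈ F, u ≠ v := fun u hu huv => hv (huv ▸ hu)
  have adj_lab : ∀ x y, (G.within F).Adj x y → lab x = lab y := fun x y hxy =>
    (h.reach x hxy.2.1 y hxy.2.2).2 hxy.reachable
  have nbr : ∀ y ∈ F, G.Adj v y → lab' y = v + 1 := fun y hy hvy =>
    hjoin y (ne y hy) ⟨y, hy, hvy, rfl⟩
  have same : ∀ x ∈ F, ∀ y ∈ F, lab x = lab y → lab' x = lab' y := by
    intro x hx y hy hxy
    by_cases hx' : ∃ a ∈ F, G.Adj v a ∧ lab a = lab x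
    · rw [hjoin x (ne x hx) hx', hjoin y (ne y hy) (by rwa [← hxy])]
    · rw [hkeep x (ne x hx) hx', hkeep y (ne y hy) (by rwa [← hxy]), hxy]
  have step : ∀ x y, (G.within (insert v F)).Adj x y → lab' x = lab' y := by
    rintro x y ⟨hxy, hx', hy⟩
    rcases Finset.mem_insert.1 hx' with rfl | hx
    · rw [hself, nbr y ((Finset.mem_insert.1 hy).resolve_left hxy.ne') hxy]
    · rcases Finset.mem_insert.1 hy with rfl | hy
      · rw [hself, nbr x ((Finset.mem_insert.1 hx').resolve_left hxy.ne) hxy.symm]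
      · exact same x hx y hy (adj_lab x y ⟨hxy, hx, hy⟩)
  have hsub := within_mono (G := G) (Finset.subset_insert v F)
  have toV : ∀ x ∈ insert v F, lab' x = v + 1 → (G.within (insert v F)).Reachable x v := by
    intro x hx hlx
    rcases Finset.mem_insert.1 hx with rfl | hx
    · exact Reachable.refl _
    · by_cases hx' : ∃ a ∈ F, G.Adj v a ∧ lab a = lab x
      · obtain ⟨a, ha, hva, hax⟩ := hx'
        have h1 := ((h.reach x hx a ha).1 hax.symm).mono hsub
        have h2 : (G.within (insert v F)).Adj a v := ⟨hva.symm, by simp [ha], by simp⟩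
        exact h1.trans h2.reachable
      · rw [hkeep x (ne x hx) hx'] at hlx
        exact absurd hlx (fresh x hx)
  refine ⟨(h.isForest_insert_iff hv).2 hd, fun u => ?_, fun x hx y hy => ⟨fun hxy => ?_, ?_⟩,
    fun u hu => ?_⟩
  · by_cases huv : u = v
    · simp [huv, hself]
    · simp only [Finset.mem_insert, huv, false_or]
      by_cases hu' : ∃ a ∈ F, G.Adj v a ∧ lab a = lab u
      · rw [hjoin u huv hu']
        obtain ⟨a, ha, -, hau⟩ := hu'
        rw [← h.mem, ← hau]
        simpa using (h.mem a).2 ha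
      · rw [hkeep u huv hu', h.mem]
  · by_cases hx1 : lab' x = v + 1
    · exact (toV x hx hx1).trans (toV y hy (hxy ▸ hx1)).symm
    · have hxv : x ≠ v := by rintro rfl; exact hx1 hself
      have hy1 : lab' y ≠ v + 1 := hxy ▸ hx1
      have hyv : y ≠ v := by rintro rfl; exact hy1 hself
      have hxF := (Finset.mem_insert.1 hx).resolve_left hxv
      have hyF := (Finset.mem_insert.1 hy).resolve_left hyv
      have hxk := hkeep x hxv (fun hc => hx1 (hjoin x hxv hc))
      have hyk := hkeep y hyv (fun hc => hy1 (hjoin y hyv hc))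
      exact ((h.reach x hxF y hyF).1 (by rw [← hxk, ← hyk, hxy])).mono hsub
  · rintro ⟨p⟩
    induction p with
    | nil => rfl
    | cons hab p ih => rw [step _ _ hab, ih hab.2.2 hy]
  · by_cases huv : u = v
    · exact ⟨v, by simp, by rw [huv, hself]⟩
    · have huF := (Finset.mem_insert.1 hu).resolve_left huv
      by_cases hu' : ∃ a ∈ F, G.Adj v a ∧ lab a = lab u
      · exact ⟨v, by simp, hjoin u huv hu'⟩
      · obtain ⟨w, hw, hroot⟩ := h.root u huF
        exact ⟨w, by simp [hw], by rw [hkeep u huv hu', hroot]⟩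

/-! ### The program -/

infixr:60 ";;" => Stmt.seq

/-- The entry of the adjacency matrix. -/
def adjE (x y : Var) : Expr := .inp (.add (.get .row (.var x)) (.var y))

/-- Records the label of `u` if `u` is a neighbour of `v` in the forest. -/
def collectBody : Stmt :=
  .ite (adjE .v .u)
    (.ite (.get .lab (.var .u))
      (.ite (.get .seen (.get .lab (.var .u))) (.set .ok (.lit 0))
        (.put .seen (.get .lab (.var .u)) (.lit 1)))
      .skip) .skip

/-- Moves `u` to the component of `v` if its label was recorded. -/
def mergeBody : Stmt :=
  .ite (.get .seen (.get .lab (.var .u))) (.put .lab (.var .u) (.add (.var .v) (.lit 1))) .skip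

/-- Adds the vertex `v` to the forest if the result is a forest. -/
def tryAddCode : Stmt :=
  .ite (.get .lab (.var .v)) .skip
    (.put .seen (.var .n) (.lit 0) ;;
    .loop .u .n (.put .seen (.var .u) (.lit 0)) ;;
    .set .ok (.lit 1) ;;
    .loop .u .n collectBody ;;
    .ite (.var .ok)
      (.loop .u .n mergeBody ;;
      .put .lab (.var .v) (.add (.var .v) (.lit 1)))
      .skip)

/-- The adjacency matrix and its row addresses are available. -/
structure HasMatrix (G : SimpleGraph (Fin n)) (M : ℕ → ℕ) (s : Env) : Prop where
  size : s.var .n = n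
  row : ∀ i < n, s.arr .row i = i * n
  adj : ∀ i j : Fin n, M (i * n + j) ≠ 0 ↔ G.Adj i j

theorem HasMatrix.congr {M : ℕ → ℕ} {s s' : Env} (h : HasMatrix G M s)
    (hn : s'.var .n = s.var .n) (hr : s'.arr .row = s.arr .row) : HasMatrix G M s' :=
  ⟨hn.trans h.size, fun i hi => by rw [hr, h.row i hi], h.adj⟩

theorem HasMatrix.eval_adjE {M : ℕ → ℕ} {s : Env} (h : HasMatrix G M s) {x y : Var} {i j : Fin n}
    (hx : s.var x = i) (hy : s.var y = j) : (adjE x y).eval M s ≠ 0 ↔ G.Adj i j := by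
  simp only [adjE, Expr.eval, hx, hy, h.row i i.2]
  exact h.adj i j

/-- The array is indexed by labels, which reach n, while the loop stops at n - 1; hence the separate
assignment to cell n. -/
theorem eval_clear_seen (M : ℕ → ℕ) {s : Env} (hn : s.var .n = n) :
    ∀ l ≤ n, ((Stmt.put .seen (.var .n) (.lit 0) ;;
      Stmt.loop .u .n (.put .seen (.var .u) (.lit 0))).eval M s).arr .seen l = 0 := by
  simp only [Stmt.eval_seq]
  set s₁ := (Stmt.put .seen (.var .n) (.lit 0)).eval M s with hs₁
  have h1 : s₁.var .n = n := hn
  have := Stmt.loop_rule M (i := .u) (x := .n) (p := .put .seen (.var .u) (.lit 0)) (s := s₁)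
    (fun m s' => s'.arr .seen n = 0 ∧ ∀ l < m, s'.arr .seen l = 0)
    ⟨by simp [hs₁, Stmt.eval, Expr.eval, Env.put_arr, hn], by simp⟩ (by
      rintro m hm s' - - ⟨i1, i2⟩
      simp only [Stmt.eval, Expr.eval, Env.put_arr, Env.set_var, Env.set_arr, true_and, if_true]
      refine ⟨by split_ifs <;> simp_all, fun l hl => ?_⟩
      split_ifs with hlm
      · rfl
      · exact i2 l (by omega))
  rw [h1] at this
  intro l hl
  rcases hl.eq_or_lt with rfl | hl
  · exact this.1
  · exact this.2 l hl

/-- The loop of `tryAddCode` that collects the labels of the neighbours. -/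
theorem eval_collect {M : ℕ → ℕ} {s : Env} (h : HasMatrix G M s) {F : Finset (Fin n)} {v : Fin n}
    (hv : s.var .v = v) (hlab : Labels G F (s.arr .lab)) (hseen : ∀ l ≤ n, s.arr .seen l = 0)
    (hok : s.var .ok = 1) {s' : Env}
    (hs' : s' = (Stmt.loop .u .n collectBody).eval M s) :
    (s'.var .ok ≠ 0 ↔ DistinctNbrs G F (s.arr .lab) v) ∧
    ∀ l ≤ n, (s'.arr .seen l ≠ 0 ↔ ∃ a ∈ F, G.Adj v a ∧ s.arr .lab a = l) := by
  have := Stmt.loop_rule M (i := .u) (x := .n) (p := collectBody) (s := s)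
    (fun m s' => (s'.var .ok ≠ 0 ↔ ∀ a ∈ F, ∀ b ∈ F, (a : ℕ) < m → (b : ℕ) < m → G.Adj v a →
        G.Adj v b → s.arr .lab a = s.arr .lab b → a = b) ∧
      ∀ l ≤ n, (s'.arr .seen l ≠ 0 ↔ ∃ a ∈ F, (a : ℕ) < m ∧ G.Adj v a ∧ s.arr .lab a = l))
    ⟨by simp [hok], by simpa using hseen⟩ (by
      rintro m hm s₁ fv fa ⟨i1, i2⟩
      rw [h.size] at hm
      have hm1 : HasMatrix G M (s₁.set .u m) := h.congr
        (by rw [Env.set_var]; simp [fv .n rfl]) (by rw [Env.set_arr, fa .row rfl])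
      have hadj := hm1.eval_adjE (x := .v) (y := .u) (i := v) (j := ⟨m, hm⟩)
        (by rw [Env.set_var]; simp [fv .v rfl, hv]) (by simp [Env.set_var])
      have hl : s₁.arr .lab = s.arr .lab := fa .lab rfl
      have hmem := hlab.mem ⟨m, hm⟩
      have hsn := i2 _ (hlab.le ⟨m, hm⟩)
      have old : ∀ a : Fin n, (a : ℕ) < m + 1 → a = ⟨m, hm⟩ ∨ (a : ℕ) < m := by
        intro a ha
        rcases Nat.lt_succ_iff_lt_or_eq.1 ha with ha | ha
        · exact Or.inr ha
        · exact Or.inl (Fin.ext ha)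
      simp only [collectBody, Stmt.eval, Expr.eval, Env.set_var, Env.set_arr, if_true, hl]
      by_cases hA : G.Adj v ⟨m, hm⟩
      · rw [if_pos (hadj.2 hA)]
        by_cases hF : (⟨m, hm⟩ : Fin n) ∈ F
        · rw [if_pos (hmem.2 hF)]
          -- A label that is already recorded comes from an earlier neighbour in the same component,
          -- exactly a failure of distinctness.
          split_ifs with hs
          · obtain ⟨a, ha, ham, hva, hab⟩ := hsn.1 hs
            refine ⟨?_, fun l hl' => ?_⟩
            · simp only [Env.set_var, if_true, ne_eq, not_true, false_iff]
              intro hall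
              have := hall a ha _ hF (by omega) (by simp) hva hA hab
              rw [this] at ham
              simp at ham
            · rw [Env.set_arr, Env.set_arr, i2 l hl']
              constructor
              · rintro ⟨b, hb, hbm, hvb, hbl⟩
                exact ⟨b, hb, by omega, hvb, hbl⟩
              · rintro ⟨b, hb, hbm, hvb, hbl⟩
                rcases old b hbm with rfl | hbm
                · exact ⟨a, ha, ham, hva, hab.trans hbl⟩
                · exact ⟨b, hb, hbm, hvb, hbl⟩
          · have hnew : ∀ a ∈ F, (a : ℕ) < m → G.Adj v a → s.arr .lab a ≠ s.arr .lab m :=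
              fun a ha ham hva hab => hs (hsn.2 ⟨a, ha, ham, hva, hab⟩)
            refine ⟨?_, fun l hl' => ?_⟩
            · simp only [Env.put_var, Env.set_var, reduceCtorEq, if_false]
              rw [i1]
              constructor
              · intro hall a ha b hb ham hbm hva hvb hab
                rcases old a ham with rfl | ham <;> rcases old b hbm with rfl | hbm
                · rfl
                · exact absurd hab.symm (hnew b hb hbm hvb)
                · exact absurd hab (hnew a ha ham hva)
                · exact hall a ha b hb ham hbm hva hvb hab
              · intro hall a ha b hb ham hbm
                exact hall a ha b hb (by omega) (by omega)
            · simp only [Env.put_arr, Env.set_arr, true_and]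
              split_ifs with hlm
              · simp only [ne_eq, one_ne_zero, not_false_eq_true, true_iff]
                exact ⟨_, hF, by simp, hA, hlm.symm⟩
              · rw [i2 l hl']
                constructor
                · rintro ⟨b, hb, hbm, hvb, hbl⟩
                  exact ⟨b, hb, by omega, hvb, hbl⟩
                · rintro ⟨b, hb, hbm, hvb, hbl⟩
                  rcases old b hbm with rfl | hbm
                  · exact absurd hbl.symm hlm
                  · exact ⟨b, hb, hbm, hvb, hbl⟩
        · rw [if_neg (fun hc => hF (hmem.1 hc))]
          refine ⟨?_, fun l hl' => ?_⟩
          · simp only [Env.set_var, reduceCtorEq, if_false]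
            rw [i1]
            constructor
            · intro hall a ha b hb ham hbm
              rcases old a ham with rfl | ham
              · exact absurd ha hF
              rcases old b hbm with rfl | hbm
              · exact absurd hb hF
              exact hall a ha b hb ham hbm
            · intro hall a ha b hb ham hbm
              exact hall a ha b hb (by omega) (by omega)
          · rw [Env.set_arr, i2 l hl']
            constructor
            · rintro ⟨b, hb, hbm, hvb, hbl⟩
              exact ⟨b, hb, by omega, hvb, hbl⟩
            · rintro ⟨b, hb, hbm, hvb, hbl⟩
              rcases old b hbm with rfl | hbm
              · exact absurd hb hF
              · exact ⟨b, hb, hbm, hvb, hbl⟩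
      · rw [if_neg (fun hc => hA (hadj.1 hc))]
        refine ⟨?_, fun l hl' => ?_⟩
        · simp only [Env.set_var, reduceCtorEq, if_false]
          rw [i1]
          constructor
          · intro hall a ha b hb ham hbm hva hvb
            rcases old a ham with rfl | ham
            · exact absurd hva hA
            rcases old b hbm with rfl | hbm
            · exact absurd hvb hA
            exact hall a ha b hb ham hbm hva hvb
          · intro hall a ha b hb ham hbm
            exact hall a ha b hb (by omega) (by omega)
        · rw [Env.set_arr, i2 l hl']
          constructor
          · rintro ⟨b, hb, hbm, hvb, hbl⟩
            exact ⟨b, hb, by omega, hvb, hbl⟩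
          · rintro ⟨b, hb, hbm, hvb, hbl⟩
            rcases old b hbm with rfl | hbm
            · exact absurd hvb hA
            · exact ⟨b, hb, hbm, hvb, hbl⟩)
  rw [h.size, ← hs'] at this
  obtain ⟨h1, h2⟩ := this
  refine ⟨h1.trans ?_, fun l hl => (h2 l hl).trans ?_⟩
  · exact ⟨fun hall a ha b hb => hall a ha b hb a.2 b.2,
      fun hall a ha b hb _ _ => hall a ha b hb⟩
  · exact ⟨fun ⟨a, ha, _, h⟩ => ⟨a, ha, h⟩, fun ⟨a, ha, h⟩ => ⟨a, ha, a.2, h⟩⟩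

/-- The loop of `tryAddCode` that merges components. -/
theorem eval_merge {M : ℕ → ℕ} {s : Env} (hn : s.var .n = n) {s' : Env}
    (hs' : s' = (Stmt.loop .u .n mergeBody).eval M s) :
    ∀ u < n, s'.arr .lab u =
      if s.arr .seen (s.arr .lab u) ≠ 0 then s.var .v + 1 else s.arr .lab u := by
  have := Stmt.loop_rule M (i := .u) (x := .n) (p := mergeBody) (s := s)
    (fun m s' => (∀ u < m, s'.arr .lab u =
      if s.arr .seen (s.arr .lab u) ≠ 0 then s.var .v + 1 else s.arr .lab u) ∧
      ∀ u, m ≤ u → s'.arr .lab u = s.arr .lab u)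
    ⟨by simp, by simp⟩ (by
      rintro m hm s₁ fv fa ⟨i1, i2⟩
      simp only [mergeBody, Stmt.eval, Expr.eval, Env.set_var, Env.set_arr, if_true, fa .seen rfl,
        i2 m le_rfl, reduceCtorEq, if_false, fv .v rfl]
      split_ifs with hs
      · simp only [Env.put_arr, Env.set_arr, true_and]
        refine ⟨fun u hu => ?_, fun u hu => ?_⟩
        · split_ifs with h1 h2 h2
          · rfl
          · exact absurd (h1 ▸ hs) h2
          · rw [i1 u (by omega), if_pos h2]
          · rw [i1 u (by omega), if_neg h2]
        · rw [if_neg (by omega), i2 u (by omega)]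
      · simp only [Env.set_arr]
        refine ⟨fun u hu => ?_, fun u hu => i2 u (by omega)⟩
        rcases Nat.lt_succ_iff_lt_or_eq.1 hu with hu | rfl
        · exact i1 u hu
        · rw [if_neg hs, i2 u le_rfl])
  rw [hn, ← hs'] at this
  exact this.1

/-- The flag `ok` decides the forest test through `Labels.isForest_insert_iff`, and merging realizes
`Labels.insert_vertex`. Vertices outside the forest have label 0, which is never recorded, so
merging leaves them alone. -/
theorem eval_tryAddCode {M : ℕ → ℕ} {s : Env} (h : HasMatrix G M s) {F : Finset (Fin n)}
    {v : Fin n} (hv : s.var .v = v) (hlab : Labels G F (s.arr .lab)) :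
    Labels G (G.tryAdd F v) ((tryAddCode.eval M s).arr .lab) := by
  have hcond : Expr.eval M s (.get .lab (.var .v)) ≠ 0 ↔ v ∈ F := by
    simp only [Expr.eval, hv]
    exact hlab.mem v
  rw [tryAddCode]
  by_cases hvF : v ∈ F
  · rw [Stmt.eval_ite_pos (hcond.2 hvF), tryAdd_of_isForest (by
      rw [Finset.insert_eq_of_mem hvF]; exact hlab.forest), Finset.insert_eq_of_mem hvF]
    exact hlab
  rw [Stmt.eval_ite_neg (fun hc => hvF (hcond.1 hc))]
  have hclear := eval_clear_seen M h.size
  simp only [Stmt.eval_seq] at hclear ⊢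
  set s₁ := (Stmt.loop .u .n (.put .seen (.var .u) (.lit 0))).eval M
    ((Stmt.put .seen (.var .n) (.lit 0)).eval M s) with hs₁
  have f1v : ∀ y, y ≠ .u → s₁.var y = s.var y := by
    intro y hy
    rw [hs₁, Stmt.eval_var M (by simp [Stmt.writes, hy]), Stmt.eval_var M (by simp [Stmt.writes])]
  have f1a : ∀ a, a ≠ .seen → s₁.arr a = s.arr a := by
    intro a ha
    rw [hs₁, Stmt.eval_arr M (by simp [Stmt.writesArr, ha]),
      Stmt.eval_arr M (by simp [Stmt.writesArr, ha])]
  set s₂ := (Stmt.set .ok (.lit 1)).eval M s₁ with hs₂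
  have hM₂ : HasMatrix G M s₂ := h.congr (f1v .n (by simp)) (f1a .row (by simp))
  have hl2 : s₂.arr .lab = s.arr .lab := f1a .lab (by simp)
  have hv2 : s₂.var .v = v := (f1v .v (by simp)).trans hv
  obtain ⟨hok, hseen⟩ := eval_collect hM₂ hv2 (hl2 ▸ hlab) (by exact hclear)
    (by simp [hs₂, Stmt.eval, Expr.eval, Env.set_var]) rfl
  generalize hs₃ : (Stmt.loop .u .n collectBody).eval M s₂ = s₃ at hok hseen ⊢
  have hl3 : s₃.arr .lab = s.arr .lab := by rw [← hs₃, Stmt.eval_arr M rfl, hl2]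
  have hv3 : s₃.var .v = v := by rw [← hs₃, Stmt.eval_var M rfl, hv2]
  have hn3 : s₃.var .n = n := by rw [← hs₃, Stmt.eval_var M rfl, hM₂.size]
  rw [hl2] at hok hseen
  have hok : (Expr.var .ok).eval M s₃ ≠ 0 ↔ G.IsForest (insert v F) :=
    hok.trans (hlab.isForest_insert_iff hvF).symm
  by_cases hf : G.IsForest (insert v F)
  · rw [Stmt.eval_ite_pos (hok.2 hf), tryAdd_of_isForest hf, Stmt.eval_seq]
    have hr := eval_merge (M := M) hn3 rfl
    generalize hs₄ : (Stmt.loop .u .n mergeBody).eval M s₃ = s₄ at hr ⊢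
    have hv4 : s₄.var .v = v := by rw [← hs₄, Stmt.eval_var M rfl, hv3]
    simp only [hl3, hv3] at hr
    refine hlab.insert_vertex hvF ((hlab.isForest_insert_iff hvF).1 hf) ?_ ?_ ?_
    · simp [Stmt.eval, Expr.eval, Env.put_arr, hv4]
    · intro u hu hex
      have : (u : ℕ) ≠ v := fun hc => hu (Fin.ext hc)
      simp only [Stmt.eval, Expr.eval, Env.put_arr, hv4, true_and, this, if_false]
      rw [hr u u.2, if_pos ((hseen _ (hlab.le u)).2 hex)]
    · intro u hu hex
      have : (u : ℕ) ≠ v := fun hc => hu (Fin.ext hc)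
      simp only [Stmt.eval, Expr.eval, Env.put_arr, hv4, true_and, this, if_false]
      rw [hr u u.2, if_neg (fun hc => hex ((hseen _ (hlab.le u)).1 hc))]
  · rw [Stmt.eval_ite_neg (fun hc => hf (hok.1 hc)), Stmt.eval, hl3, SimpleGraph.tryAdd, if_neg hf]
    exact hlab

end RAM

/-! ### Executing one instruction. -/

namespace RAM

open SimpleGraph

variable {n : ℕ} {G : SimpleGraph (Fin n)} {C : Finset (Fin n)}

/-- Tests whether `x` fits the marks. -/
def fitsBody : Stmt :=
  .ite (.get .cov (.var .u))
    (.ite (.get .mark (.var .u))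
      (.ite (adjE .x .u) .skip (.set .ok (.lit 0)))
      (.ite (adjE .x .u) (.ite (.get .lab (.var .u)) (.set .ok (.lit 0)) .skip) .skip))
    .skip

/-- The candidate is stored in `g` shifted by one, so that 0 means that no vertex fits. Later
candidates overwrite earlier ones, which matches `lastSat`. -/
def pickBody : Stmt :=
  .ite (.get .cov (.var .x)) .skip
    (.set .ok (.lit 1) ;;
    .loop .u .n fitsBody ;;
    .ite (.var .ok) (.set .g (.add (.var .x) (.lit 1))) .skip)

def flushCode : Stmt :=
  .set .g (.lit 0) ;;
  .loop .x .n pickBody ;;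
  .loop .u .n (.put .mark (.var .u) (.lit 0)) ;;
  .ite (.var .g) (.set .v (.sub (.var .g) (.lit 1)) ;; tryAddCode) .skip

/-- Performs the instruction with code `d`. -/
def instrCode : Stmt :=
  .ite (.var .d)
    (.ite (.sub (.var .d) (.lit 1))
      (.ite (.sub (.add (.var .c) (.lit 2)) (.var .d))
        (.set .v (.get .lst (.sub (.var .d) (.lit 2))) ;; tryAddCode)
        (.put .mark (.get .lst (.sub (.sub (.var .d) (.lit 2)) (.var .c))) (.lit 1)))
      flushCode)
    .skip

/-- What the enumeration of instruction lists relies on and never changes. -/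
structure Prepared (G : SimpleGraph (Fin n)) (C : Finset (Fin n)) (M : ℕ → ℕ) (s : Env) : Prop
    extends HasMatrix G M s where
  cov : ∀ v : Fin n, s.arr .cov v ≠ 0 ↔ v ∈ C
  card : s.var .c = C.card
  base : s.var .b = 2 * C.card + 2
  lst_lt : ∀ i < C.card, s.arr .lst i < n
  lst_surj : ∀ v ∈ C, ∃ i < C.card, s.arr .lst i = (v : ℕ)

theorem Prepared.congr {M : ℕ → ℕ} {s s' : Env} (h : Prepared G C M s)
    (hv : ∀ y ∈ [Var.n, Var.c, Var.b], s'.var y = s.var y)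
    (ha : ∀ a ∈ [Arr.row, Arr.cov, Arr.lst], s'.arr a = s.arr a) : Prepared G C M s' where
  toHasMatrix := h.toHasMatrix.congr (hv _ (by simp)) (ha _ (by simp))
  cov v := by rw [ha .cov (by simp), h.cov]
  card := by rw [hv .c (by simp), h.card]
  base := by rw [hv .b (by simp), h.base]
  lst_lt i hi := by rw [ha .lst (by simp)]; exact h.lst_lt i hi
  lst_surj v hv := by rw [ha .lst (by simp)]; exact h.lst_surj v hv

/-- The statement writes nothing that `Prepared` mentions. -/
def Stmt.Keeps (p : Stmt) : Bool :=
  [Var.n, Var.c, Var.b].all (fun y => !p.writes y) &&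
    [Arr.row, Arr.cov, Arr.lst].all (fun a => !p.writesArr a)

theorem Prepared.of_keeps {M : ℕ → ℕ} {s s' : Env} (h : Prepared G C M s) {p : Stmt}
    (hp : p.Keeps = true) (hv : ∀ y, p.writes y = false → s'.var y = s.var y)
    (ha : ∀ a, p.writesArr a = false → s'.arr a = s.arr a) : Prepared G C M s' := by
  simp only [Stmt.Keeps, Bool.and_eq_true, List.all_eq_true, Bool.not_eq_true'] at hp
  exact h.congr (fun y hy => hv y (hp.1 y hy)) (fun a h' => ha a (hp.2 a h'))

/-- `Keeps` is a Boolean, so for concrete code the frame condition is proved by `rfl`. -/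
theorem Prepared.eval {M : ℕ → ℕ} {s : Env} (h : Prepared G C M s) {p : Stmt}
    (hp : p.Keeps = true) : Prepared G C M (p.eval M s) :=
  h.of_keeps hp (fun _ hy => Stmt.eval_var M hy s) (fun _ ha => Stmt.eval_arr M ha s)

theorem Prepared.set {M : ℕ → ℕ} {s : Env} (h : Prepared G C M s) {x : Var}
    (hx : x ∉ [Var.n, Var.c, Var.b]) (v : ℕ) : Prepared G C M (s.set x v) :=
  h.congr (fun y hy => by rw [Env.set_var, if_neg (by rintro rfl; exact hx hy)])
    (fun _ _ => rfl)

/-- The arrays `lab` and `mark` represent the forest and the set of marked vertices. -/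
structure Holds (G : SimpleGraph (Fin n)) (σ : Finset (Fin n) × Finset (Fin n)) (s : Env) :
    Prop where
  lab : Labels G σ.1 (s.arr .lab)
  mark : ∀ v : Fin n, s.arr .mark v ≠ 0 ↔ v ∈ σ.2

theorem eval_fits {M : ℕ → ℕ} {s : Env} (h : Prepared G C M s) {σ : Finset (Fin n) × Finset (Fin n)}
    (hσ : Holds G σ s) {v : Fin n} (hv : s.var .x = v) (hok : s.var .ok = 1) :
    ((Stmt.loop .u .n fitsBody).eval M s).var .ok ≠ 0 ↔
      ∀ x ∈ C, (x ∈ σ.2 → G.Adj v x) ∧ (G.Adj v x → x ∈ σ.1 → x ∈ σ.2) := by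
  have := Stmt.loop_rule M (i := .u) (x := .n) (p := fitsBody) (s := s)
    (fun m s' => s'.var .ok ≠ 0 ↔ ∀ x ∈ C, (x : ℕ) < m →
      (x ∈ σ.2 → G.Adj v x) ∧ (G.Adj v x → x ∈ σ.1 → x ∈ σ.2))
    (by simp [hok]) (by
      intro m hm s' fv fa ih
      rw [h.size] at hm
      have hP : Prepared G C M (s'.set .u m) := (h.of_keeps rfl fv fa).set (by simp) m
      have hadj := hP.eval_adjE (x := .x) (y := .u) (i := v) (j := ⟨m, hm⟩)
        (by rw [Env.set_var]; simp [fv .x rfl, hv]) (by simp [Env.set_var])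
      have hcov := hP.cov ⟨m, hm⟩
      have hmark := hσ.mark ⟨m, hm⟩
      have hlab := hσ.lab.mem ⟨m, hm⟩
      rw [← fa .mark rfl] at hmark
      rw [← fa .lab rfl] at hlab
      have split : (∀ x ∈ C, (x : ℕ) < m + 1 →
          (x ∈ σ.2 → G.Adj v x) ∧ (G.Adj v x → x ∈ σ.1 → x ∈ σ.2)) ↔
          (∀ x ∈ C, (x : ℕ) < m → (x ∈ σ.2 → G.Adj v x) ∧ (G.Adj v x → x ∈ σ.1 → x ∈ σ.2)) ∧
          (⟨m, hm⟩ ∈ C → (⟨m, hm⟩ ∈ σ.2 → G.Adj v ⟨m, hm⟩) ∧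
            (G.Adj v ⟨m, hm⟩ → ⟨m, hm⟩ ∈ σ.1 → ⟨m, hm⟩ ∈ σ.2)) := by
        refine ⟨fun hP => ⟨fun a haC ha => hP a haC (by omega), fun hmC => hP _ hmC (by simp)⟩,
          fun hP a haC ha => ?_⟩
        rcases Nat.lt_succ_iff_lt_or_eq.1 ha with ha | ha
        · exact hP.1 a haC ha
        · obtain rfl : a = ⟨m, hm⟩ := Fin.ext ha
          exact hP.2 haC
      rw [split, ← ih]
      simp only [Env.set_arr] at hcov
      simp only [fitsBody, Stmt.eval, Expr.eval, Env.set_var, Env.set_arr, if_true]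
      simp only [hcov, hmark, hlab, hadj]
      split_ifs <;> simp_all [Env.set_var])
  rw [h.size] at this
  rw [this]
  exact ⟨fun hall x hx => hall x hx x.2, fun hall x hx _ => hall x hx⟩

open Classical in
/-- The last vertex among the first `m` that satisfies `P`. -/
noncomputable def lastSat (P : Fin n → Prop) : ℕ → Option (Fin n)
  | 0 => none
  | m + 1 => if h : ∃ hm : m < n, P ⟨m, hm⟩ then some ⟨m, h.1⟩ else lastSat P m

theorem lastSat_some {P : Fin n → Prop} {m : ℕ} {v : Fin n} (h : lastSat P m = some v) : P v := by
  induction m with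
  | zero => simp [lastSat] at h
  | succ m ih =>
    rw [lastSat] at h
    split_ifs at h with hm
    · obtain rfl := Option.some.inj h
      exact hm.2
    · exact ih h

theorem lastSat_none {P : Fin n → Prop} {m : ℕ} (h : lastSat P m = none) (v : Fin n)
    (hv : (v : ℕ) < m) : ¬ P v := by
  induction m with
  | zero => omega
  | succ m ih =>
    rw [lastSat] at h
    split_ifs at h with hm
    rcases Nat.lt_succ_iff_lt_or_eq.1 hv with hv | hv
    · exact ih h hv
    · subst hv
      exact fun hP => hm ⟨v.2, hP⟩

/-- The vertex chosen when the marks are flushed. -/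
noncomputable def pickLast (P : Fin n → Prop) : Option (Fin n) := lastSat P n

theorem eval_pick {M : ℕ → ℕ} {s : Env} (h : Prepared G C M s)
    {σ : Finset (Fin n) × Finset (Fin n)} (hσ : Holds G σ s) (hg : s.var .g = 0) :
    ((Stmt.loop .x .n pickBody).eval M s).var .g =
      (pickLast (G.Fits C σ.1 σ.2)).elim 0 (fun v => (v : ℕ) + 1) := by
  have := Stmt.loop_rule M (i := .x) (x := .n) (p := pickBody) (s := s)
    (fun m s' => s'.var .g = (lastSat (G.Fits C σ.1 σ.2) m).elim 0 (fun v => (v : ℕ) + 1))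
    (by simp [hg, lastSat]) (by
      intro m hm s' fv fa ih
      rw [h.size] at hm
      have hP : Prepared G C M (s'.set .x m) := (h.of_keeps rfl fv fa).set (by simp) m
      have hcov : (Expr.get .cov (.var .x)).eval M (s'.set .x m) ≠ 0 ↔ ⟨m, hm⟩ ∈ C := by
        have := hP.cov ⟨m, hm⟩
        simpa [Expr.eval, Env.set_var] using this
      rw [pickBody, lastSat]
      by_cases hC : (⟨m, hm⟩ : Fin n) ∈ C
      · rw [Stmt.eval_ite_pos (hcov.2 hC), dif_neg (fun ⟨_, hc⟩ => hc.1 hC)]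
        simpa [Stmt.eval, Env.set_var] using ih
      · rw [Stmt.eval_ite_neg (fun hc => hC (hcov.1 hc)), Stmt.eval_seq, Stmt.eval_seq]
        set s₁ := (Stmt.set .ok (.lit 1)).eval M (s'.set .x m) with hs₁
        have hP₁ : Prepared G C M s₁ := hP.eval rfl
        have hσ₁ : Holds G σ s₁ := by
          refine ⟨?_, ?_⟩
          · simpa [hs₁, Stmt.eval, Env.set_arr, fa .lab rfl] using hσ.lab
          · simpa [hs₁, Stmt.eval, Env.set_arr, fa .mark rfl] using hσ.mark
        have hf := eval_fits hP₁ hσ₁ (v := ⟨m, hm⟩)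
          (by simp [hs₁, Stmt.eval, Expr.eval, Env.set_var])
          (by simp [hs₁, Stmt.eval, Expr.eval, Env.set_var])
        generalize hs₂ : (Stmt.loop .u .n fitsBody).eval M s₁ = s₂ at hf ⊢
        have hg₂ : s₂.var .g = s'.var .g := by
          rw [← hs₂, Stmt.eval_var M rfl]
          simp [hs₁, Stmt.eval, Env.set_var]
        have hx₂ : s₂.var .x = m := by
          rw [← hs₂, Stmt.eval_var M rfl]
          simp [hs₁, Stmt.eval, Env.set_var]
        have hf' : (Expr.var .ok).eval M s₂ ≠ 0 ↔ G.Fits C σ.1 σ.2 ⟨m, hm⟩ :=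
          hf.trans ⟨fun h => ⟨hC, h⟩, fun h => h.2⟩
        by_cases hfit : G.Fits C σ.1 σ.2 ⟨m, hm⟩
        · rw [Stmt.eval_ite_pos (hf'.2 hfit), dif_pos ⟨hm, hfit⟩]
          simp [Stmt.eval, Expr.eval, Env.set_var, hx₂]
        · rw [Stmt.eval_ite_neg (fun hc => hfit (hf'.1 hc)), dif_neg (fun ⟨_, hc⟩ => hfit hc)]
          simpa [Stmt.eval, hg₂] using ih)
  rw [h.size] at this
  exact this

theorem eval_clear (M : ℕ → ℕ) {a : Arr} {s : Env} {u : Var} (hn : s.var .n = n) :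
    ∀ l < n, ((Stmt.loop u .n (.put a (.var u) (.lit 0))).eval M s).arr a l = 0 := by
  have := Stmt.loop_rule M (i := u) (x := .n) (p := .put a (.var u) (.lit 0)) (s := s)
    (fun m s' => ∀ l < m, s'.arr a l = 0) (by simp) (by
      intro m hm s' _ _ ih l hl
      simp only [Stmt.eval, Expr.eval, Env.put_arr, Env.set_var, Env.set_arr, true_and, if_true]
      split_ifs with hlm
      · rfl
      · exact ih l (by omega))
  rwa [hn] at this

theorem Holds.tryAdd {M : ℕ → ℕ} {s : Env} (h : Prepared G C M s)
    {σ : Finset (Fin n) × Finset (Fin n)} (hσ : Holds G σ s) {v : Fin n} (hv : s.var .v = v) :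
    Holds G (G.tryAdd σ.1 v, σ.2) (tryAddCode.eval M s) :=
  ⟨eval_tryAddCode h.toHasMatrix hv hσ.lab, by rw [Stmt.eval_arr M rfl]; exact hσ.mark⟩

theorem Holds.set {s : Env} {σ : Finset (Fin n) × Finset (Fin n)} (hσ : Holds G σ s) (x : Var)
    (v : ℕ) : Holds G σ (s.set x v) := ⟨hσ.lab, hσ.mark⟩

theorem Holds.congr {s s' : Env} {σ : Finset (Fin n) × Finset (Fin n)} (hσ : Holds G σ s)
    (hl : s'.arr .lab = s.arr .lab) (hm : s'.arr .mark = s.arr .mark) : Holds G σ s' :=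
  ⟨by rw [hl]; exact hσ.lab, by rw [hm]; exact hσ.mark⟩

theorem eval_flushCode {M : ℕ → ℕ} {s : Env} (h : Prepared G C M s)
    {σ : Finset (Fin n) × Finset (Fin n)} (hσ : Holds G σ s) :
    Holds G (Instr.run G pickLast C σ .flush) (flushCode.eval M s) := by
  rw [flushCode, Stmt.eval_seq, Stmt.eval_seq, Stmt.eval_seq]
  set s₁ := (Stmt.set .g (.lit 0)).eval M s with hs₁
  have hP₁ : Prepared G C M s₁ := h.eval rfl
  have hσ₁ : Holds G σ s₁ := hσ.set _ _
  have hg := eval_pick hP₁ hσ₁ (by simp [hs₁, Stmt.eval, Expr.eval, Env.set_var])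
  have hP₂ : Prepared G C M ((Stmt.loop .x .n pickBody).eval M s₁) := hP₁.eval rfl
  have hσ₂ : Holds G σ ((Stmt.loop .x .n pickBody).eval M s₁) :=
    hσ₁.congr (Stmt.eval_arr M rfl _) (Stmt.eval_arr M rfl _)
  generalize (Stmt.loop .x .n pickBody).eval M s₁ = s₂ at hg hP₂ hσ₂ ⊢
  have hclear := eval_clear M (a := .mark) (u := .u) hP₂.size
  have hP₃ : Prepared G C M ((Stmt.loop .u .n (.put .mark (.var .u) (.lit 0))).eval M s₂) :=
    hP₂.eval rfl
  have hσ₃ : Holds G (σ.1, ∅) ((Stmt.loop .u .n (.put .mark (.var .u) (.lit 0))).eval M s₂) :=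
    ⟨by rw [Stmt.eval_arr M rfl]; exact hσ₂.lab, fun v => by simp [hclear v v.2]⟩
  have hg₃ : ((Stmt.loop .u .n (.put .mark (.var .u) (.lit 0))).eval M s₂).var .g = s₂.var .g :=
    Stmt.eval_var M rfl _
  generalize (Stmt.loop .u .n (.put .mark (.var .u) (.lit 0))).eval M s₂ = s₃
    at hclear hP₃ hσ₃ hg₃ ⊢
  rw [hg] at hg₃
  simp only [Instr.run]
  cases hp : pickLast (G.Fits C σ.1 σ.2) with
  | none =>
    rw [Stmt.eval_ite_neg (by simp [Expr.eval, hg₃, hp])]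
    exact hσ₃
  | some v =>
    rw [Stmt.eval_ite_pos (by simp [Expr.eval, hg₃, hp]), Stmt.eval_seq]
    refine Holds.tryAdd (C := C) (hP₃.set (x := .v) (by simp) _) (hσ₃.set _ _) ?_
    simp [Expr.eval, Env.set_var, hg₃, hp]

/-- The instruction with code `d`, for a vertex cover listed by `lst`. -/
def decode (n c : ℕ) (lst : ℕ → ℕ) (d : ℕ) : Instr (Fin n) :=
  if d = 0 then .nop
  else if d = 1 then .flush
  else if d < c + 2 then
    if h : lst (d - 2) < n then .add ⟨_, h⟩ else .nop
  else
    if h : lst (d - 2 - c) < n then .mark ⟨_, h⟩ else .nop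

/-- Code 0 is `nop` and 1 is `flush`; then come |C| codes for `add` and |C| for `mark`, which is why
the base of the digits is 2|C| + 2. -/
theorem eval_instrCode {M : ℕ → ℕ} {s : Env} (h : Prepared G C M s)
    {σ : Finset (Fin n) × Finset (Fin n)} (hσ : Holds G σ s) (hd : s.var .d < 2 * C.card + 2) :
    Holds G (Instr.run G pickLast C σ (decode n C.card (s.arr .lst) (s.var .d)))
      (instrCode.eval M s) := by
  rw [instrCode, decode]
  by_cases h0 : s.var .d = 0
  · rw [if_pos h0, Stmt.eval_ite_neg (by simp [Expr.eval, h0])]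
    exact hσ
  rw [if_neg h0, Stmt.eval_ite_pos (by simpa [Expr.eval] using h0)]
  by_cases h1 : s.var .d = 1
  · rw [if_pos h1, Stmt.eval_ite_neg (by simp [Expr.eval, h1])]
    exact eval_flushCode h hσ
  rw [if_neg h1, Stmt.eval_ite_pos (by simp only [Expr.eval]; omega)]
  by_cases h2 : s.var .d < C.card + 2
  · have hlt := h.lst_lt (s.var .d - 2) (by omega)
    rw [if_pos h2, dif_pos hlt,
      Stmt.eval_ite_pos (by simp only [Expr.eval, h.card]; omega), Stmt.eval_seq]
    exact Holds.tryAdd (C := C) (h.eval rfl) (hσ.set _ _)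
      (by simp [Stmt.eval, Expr.eval, Env.set_var])
  · have hlt := h.lst_lt (s.var .d - 2 - C.card) (by omega)
    rw [if_neg h2, dif_pos hlt, Stmt.eval_ite_neg (by simp only [Expr.eval, h.card]; omega)]
    refine ⟨?_, fun v => ?_⟩
    · rw [Stmt.eval_arr M rfl]
      exact hσ.lab
    · simp only [Stmt.eval, Expr.eval, Env.put_arr, true_and, h.card, Instr.run,
        Finset.mem_insert]
      split_ifs with hv
      · simp [Fin.ext_iff, hv]
      · rw [hσ.mark]
        simp [Fin.ext_iff, hv]

end RAM

/-! ### Numbers as instruction lists, and the exhaustive search. -/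

namespace RAM

open SimpleGraph

variable {n : ℕ} {G : SimpleGraph (Fin n)} {C : Finset (Fin n)}

/-! ### Reading an instruction list off a number -/

def divBody : Stmt :=
  .ite (.sub (.var .t) (.sub (.var .b) (.lit 1)))
    (.set .t (.sub (.var .t) (.var .b)) ;; .set .q (.add (.var .q) (.lit 1))) .skip

def digitBody : Stmt :=
  .set .q (.lit 0) ;;
  .loop .y .pow divBody ;;
  .set .d (.var .t) ;;
  .set .t (.var .q) ;;
  instrCode

theorem eval_div (M : ℕ → ℕ) {s : Env} (hb : 2 ≤ s.var .b) (hq : s.var .q = 0)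
    (ht : s.var .t < s.var .pow) :
    ((Stmt.loop .y .pow divBody).eval M s).var .t = s.var .t % s.var .b ∧
      ((Stmt.loop .y .pow divBody).eval M s).var .q = s.var .t / s.var .b := by
  have := Stmt.loop_rule M (i := .y) (x := .pow) (p := divBody) (s := s)
    (fun m s' => s'.var .t + s.var .b * s'.var .q = s.var .t ∧
      (s'.var .t < s.var .b ∨ s'.var .q = m)) (by simp [hq]) (by
      rintro m hm s' fv - ⟨i1, i2⟩
      simp only [divBody, Stmt.eval, Expr.eval, Env.set_var, reduceCtorEq, if_false, fv .b rfl]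
      split_ifs with hc
      · simp only [Env.set_var, reduceCtorEq, if_false, if_true]
        refine ⟨?_, by omega⟩
        rw [Nat.mul_add]
        omega
      · simp only [Env.set_var, reduceCtorEq, if_false]
        exact ⟨i1, Or.inl (by omega)⟩)
  generalize (Stmt.loop .y .pow divBody).eval M s = s' at this ⊢
  obtain ⟨h1, h2⟩ := this
  -- If every round had subtracted, the quotient would be `pow`, and b · `pow` would not exceed the
  -- dividend, which is below `pow`.
  have h3 : s'.var .t < s.var .b := by
    refine h2.resolve_right fun hq' => ?_
    rw [hq'] at h1
    have := Nat.mul_le_mul_right (s.var .pow) hb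
    omega
  rw [← h1]
  refine ⟨?_, ?_⟩
  · rw [Nat.add_mul_mod_self_left, Nat.mod_eq_of_lt h3]
  · rw [Nat.add_mul_div_left _ _ (by omega), Nat.div_eq_of_lt h3, Nat.zero_add]

/-- The first `N` instructions coded by the base `b` digits of `w`. -/
def instrs (n c b : ℕ) (lst : ℕ → ℕ) (N w : ℕ) : List (Instr (Fin n)) :=
  (List.range N).map fun j => decode n c lst (w / b ^ j % b)

/-- Digits are consumed from the least significant one, and t carries the remaining quotient. The
loop reads `pow` digits rather than 4|C|; this costs a polynomial factor in `pow` and needs no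
further variable. -/
theorem eval_digits {M : ℕ → ℕ} {s : Env} (h : Prepared G C M s) (hσ : Holds G (∅, ∅) s)
    (ht : s.var .t < s.var .pow) :
    Holds G ((instrs n C.card (2 * C.card + 2) (s.arr .lst) (s.var .pow) (s.var .t)).foldl
      (Instr.run G pickLast C) (∅, ∅)) ((Stmt.loop .z .pow digitBody).eval M s) := by
  refine (Stmt.loop_rule M (i := .z) (x := .pow) (p := digitBody) (s := s)
    (fun m s' => s'.var .t = s.var .t / (2 * C.card + 2) ^ m ∧
      Holds G ((instrs n C.card (2 * C.card + 2) (s.arr .lst) m (s.var .t)).foldl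
      (Instr.run G pickLast C) (∅, ∅)) s') ⟨by simp, hσ⟩ ?_).2
  rintro m hm s' fv fa ⟨i1, i2⟩
  have hP : Prepared G C M ((s'.set .z m).set .q 0) :=
    ((h.of_keeps rfl fv fa).set (by simp) m).set (by simp) 0
  rw [digitBody, Stmt.eval_seq, Stmt.eval_seq, Stmt.eval_seq, Stmt.eval_seq]
  set s₁ := (Stmt.set .q (.lit 0)).eval M (s'.set .z m) with hs₁
  have hP₁ : Prepared G C M s₁ := hP
  have ht₁ : s₁.var .t = s'.var .t := rfl
  have hp₁ : s₁.var .pow = s.var .pow := fv .pow rfl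
  have hlt : s'.var .t < s.var .pow := by
    rw [i1]
    exact (Nat.div_le_self _ _).trans_lt ht
  obtain ⟨hdt, hdq⟩ := eval_div M (s := s₁) (by rw [hP₁.base]; omega) rfl
    (by rw [ht₁, hp₁]; exact hlt)
  have hP₂ : Prepared G C M ((Stmt.loop .y .pow divBody).eval M s₁) := hP₁.eval rfl
  have hl₂ : ((Stmt.loop .y .pow divBody).eval M s₁).arr .lab = s'.arr .lab :=
    Stmt.eval_arr M rfl _
  have hm₂ : ((Stmt.loop .y .pow divBody).eval M s₁).arr .mark = s'.arr .mark :=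
    Stmt.eval_arr M rfl _
  have hlst₂ : ((Stmt.loop .y .pow divBody).eval M s₁).arr .lst = s.arr .lst :=
    (Stmt.eval_arr M rfl _).trans (fa .lst rfl)
  generalize (Stmt.loop .y .pow divBody).eval M s₁ = s₂ at hdt hdq hP₂ hl₂ hm₂ hlst₂ ⊢
  rw [ht₁, hP₁.base, i1] at hdt hdq
  set s₃ := (Stmt.set .t (.var .q)).eval M ((Stmt.set .d (.var .t)).eval M s₂) with hs₃
  have hP₃ : Prepared G C M s₃ := (hP₂.eval rfl).eval rfl
  have hd₃ : s₃.var .d = s.var .t / (2 * C.card + 2) ^ m % (2 * C.card + 2) := by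
    simp [hs₃, Stmt.eval, Expr.eval, Env.set_var, hdt]
  have ht₃ : s₃.var .t = s.var .t / (2 * C.card + 2) ^ (m + 1) := by
    simp [hs₃, Stmt.eval, Expr.eval, Env.set_var, hdq, pow_succ, Nat.div_div_eq_div_mul]
  refine ⟨by rw [Stmt.eval_var M rfl, ht₃], ?_⟩
  have hlst₃ : s₃.arr .lst = s.arr .lst := hlst₂
  have := eval_instrCode hP₃ (i2.congr (s' := s₃) hl₂ hm₂)
    (by rw [hd₃]; exact Nat.mod_lt _ (by omega))
  rw [hlst₃, hd₃] at this
  rw [instrs, List.range_succ, List.map_append, List.foldl_append]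
  exact this

/-! ### Completing a forest and counting -/

/-- Matches a loop over vertex numbers with a fold over `List.finRange`, one round at a time. -/
theorem foldl_take_finRange_succ {α : Type*} (f : α → Fin n → α) (a : α) {m : ℕ} (hm : m < n) :
    ((List.finRange n).take (m + 1)).foldl f a =
      f (((List.finRange n).take m).foldl f a) ⟨m, hm⟩ := by
  rw [List.take_succ_eq_append_getElem (by simpa using hm), List.foldl_append]
  simp

theorem card_filter_lt_succ (P : Fin n → Prop) [DecidablePred P] {m : ℕ} (hm : m < n) :
    (Finset.univ.filter fun a : Fin n => (a : ℕ) < m + 1 ∧ P a).card =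
      (Finset.univ.filter fun a : Fin n => (a : ℕ) < m ∧ P a).card + if P ⟨m, hm⟩ then 1 else 0 := by
  split_ifs with hP
  · rw [← Finset.card_insert_of_notMem (a := (⟨m, hm⟩ : Fin n)) (by simp)]
    congr 1
    ext a
    simp only [Finset.mem_filter, Finset.mem_univ, true_and, Finset.mem_insert, Fin.ext_iff]
    constructor
    · rintro ⟨h1, h2⟩
      rcases Nat.lt_succ_iff_lt_or_eq.1 h1 with h | h
      · exact Or.inr ⟨h, h2⟩
      · exact Or.inl h
    · rintro (h | ⟨h1, h2⟩)
      · obtain rfl : a = ⟨m, hm⟩ := Fin.ext h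
        exact ⟨by simp, hP⟩
      · exact ⟨by omega, h2⟩
  · refine (congrArg Finset.card (Finset.ext fun a => ?_)).trans (Nat.add_zero _).symm
    simp only [Finset.mem_filter, Finset.mem_univ, true_and]
    constructor
    · rintro ⟨h1, h2⟩
      rcases Nat.lt_succ_iff_lt_or_eq.1 h1 with h | h
      · exact ⟨h, h2⟩
      · obtain rfl : a = ⟨m, hm⟩ := Fin.ext h
        exact absurd h2 hP
    · rintro ⟨h1, h2⟩
      exact ⟨by omega, h2⟩

def incr : Stmt := .set .cnt (.add (.var .cnt) (.lit 1))

def nbrBody : Stmt :=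
  .ite (.get .cov (.var .u)) (.ite (.get .lab (.var .u)) (.ite (adjE .x .u) incr .skip) .skip) .skip

def leafBody : Stmt :=
  .ite (.get .cov (.var .x)) .skip
    (.set .cnt (.lit 0) ;;
    .loop .u .n nbrBody ;;
    .ite (.sub (.lit 2) (.var .cnt)) (.set .v (.var .x) ;; tryAddCode) .skip)

def tryBody : Stmt := .set .v (.var .x) ;; tryAddCode

def countBody : Stmt := .ite (.get .lab (.var .u)) incr .skip

open Classical in
theorem eval_nbrs {M : ℕ → ℕ} {s : Env} (h : Prepared G C M s) {F : Finset (Fin n)}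
    (hF : Labels G F (s.arr .lab)) {v : Fin n} (hv : s.var .x = v) (hcnt : s.var .cnt = 0) :
    ((Stmt.loop .u .n nbrBody).eval M s).var .cnt =
      (C.filter fun x => x ∈ F ∧ G.Adj v x).card := by
  have := Stmt.loop_rule M (i := .u) (x := .n) (p := nbrBody) (s := s)
    (fun m s' => s'.var .cnt = (Finset.univ.filter fun a : Fin n =>
      (a : ℕ) < m ∧ (a ∈ C ∧ a ∈ F ∧ G.Adj v a)).card) (by simp [hcnt]) (by
      intro m hm s' fv fa ih
      rw [h.size] at hm
      have hP : Prepared G C M (s'.set .u m) := (h.of_keeps rfl fv fa).set (by simp) m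
      have hadj := hP.eval_adjE (x := .x) (y := .u) (i := v) (j := ⟨m, hm⟩)
        (by rw [Env.set_var]; simp [fv .x rfl, hv]) (by simp [Env.set_var])
      have hcov := hP.cov ⟨m, hm⟩
      have hlab := hF.mem ⟨m, hm⟩
      rw [← fa .lab rfl] at hlab
      simp only [Env.set_arr] at hcov
      rw [card_filter_lt_succ (fun a => a ∈ C ∧ a ∈ F ∧ G.Adj v a) hm, ← ih]
      simp only [nbrBody, incr, Stmt.eval, Expr.eval, Env.set_var, Env.set_arr, if_true]
      simp only [hcov, hlab, hadj]
      split_ifs <;> simp_all [Env.set_var])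
  rw [h.size] at this
  rw [this]
  congr 1
  ext a
  simp

theorem eval_leaves {M : ℕ → ℕ} {s : Env} (h : Prepared G C M s) {F : Finset (Fin n)}
    (hF : Labels G F (s.arr .lab)) :
    Labels G ((List.finRange n).foldl (G.tryLeaf C) F)
      (((Stmt.loop .x .n leafBody).eval M s).arr .lab) := by
  have := Stmt.loop_rule M (i := .x) (x := .n) (p := leafBody) (s := s)
    (fun m s' => Labels G (((List.finRange n).take m).foldl (G.tryLeaf C) F) (s'.arr .lab))
    (by simpa using hF) (by
      intro m hm s' fv fa ih
      rw [h.size] at hm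
      have hP : Prepared G C M (s'.set .x m) := (h.of_keeps rfl fv fa).set (by simp) m
      have hcov : (Expr.get .cov (.var .x)).eval M (s'.set .x m) ≠ 0 ↔ ⟨m, hm⟩ ∈ C := by
        have := hP.cov ⟨m, hm⟩
        simpa [Expr.eval, Env.set_var] using this
      rw [foldl_take_finRange_succ _ _ hm, tryLeaf, leafBody]
      by_cases hC : (⟨m, hm⟩ : Fin n) ∈ C
      · rw [Stmt.eval_ite_pos (hcov.2 hC), if_neg (fun hc => hc.1 hC)]
        exact ih
      · rw [Stmt.eval_ite_neg (fun hc => hC (hcov.1 hc)), Stmt.eval_seq, Stmt.eval_seq]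
        set s₁ := (Stmt.set .cnt (.lit 0)).eval M (s'.set .x m) with hs₁
        have hP₁ : Prepared G C M s₁ := hP.eval rfl
        have hc := eval_nbrs hP₁ (v := ⟨m, hm⟩) ih
          (by simp [hs₁, Stmt.eval, Env.set_var]) (by simp [hs₁, Stmt.eval, Expr.eval, Env.set_var])
        have hP₂ : Prepared G C M ((Stmt.loop .u .n nbrBody).eval M s₁) := hP₁.eval rfl
        have hl₂ : ((Stmt.loop .u .n nbrBody).eval M s₁).arr .lab = s'.arr .lab :=
          Stmt.eval_arr M rfl _
        have hx₂ : ((Stmt.loop .u .n nbrBody).eval M s₁).var .x = m := by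
          rw [Stmt.eval_var M rfl]
          simp [hs₁, Stmt.eval, Env.set_var]
        generalize (Stmt.loop .u .n nbrBody).eval M s₁ = s₂ at hc hP₂ hl₂ hx₂ ⊢
        rw [← hl₂] at ih
        by_cases hle : s₂.var .cnt ≤ 1
        · rw [Stmt.eval_ite_pos (by simp only [Expr.eval]; omega), if_pos ⟨hC, hc ▸ hle⟩,
            Stmt.eval_seq]
          exact eval_tryAddCode (hP₂.set (x := .v) (by simp) _).toHasMatrix
            (by simp [Expr.eval, Env.set_var, hx₂]) ih
        · rw [Stmt.eval_ite_neg (by simp only [Expr.eval]; omega), if_neg (fun h => hle (hc ▸ h.2))]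
          exact ih)
  rwa [h.size, List.take_of_length_le (by simp)] at this

theorem eval_tries {M : ℕ → ℕ} {s : Env} (h : Prepared G C M s) {F : Finset (Fin n)}
    (hF : Labels G F (s.arr .lab)) :
    Labels G ((List.finRange n).foldl G.tryAdd F)
      (((Stmt.loop .x .n tryBody).eval M s).arr .lab) := by
  have := Stmt.loop_rule M (i := .x) (x := .n) (p := tryBody) (s := s)
    (fun m s' => Labels G (((List.finRange n).take m).foldl G.tryAdd F) (s'.arr .lab))
    (by simpa using hF) (by
      intro m hm s' fv fa ih
      rw [h.size] at hm
      have hP : Prepared G C M (s'.set .x m) := (h.of_keeps rfl fv fa).set (by simp) m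
      rw [foldl_take_finRange_succ _ _ hm, tryBody, Stmt.eval_seq]
      exact eval_tryAddCode (hP.set (x := .v) (by simp) _).toHasMatrix
        (by simp [Expr.eval, Env.set_var]) ih)
  rwa [h.size, List.take_of_length_le (by simp)] at this

theorem eval_count (M : ℕ → ℕ) {s : Env} (hn : s.var .n = n) {F : Finset (Fin n)}
    (hF : Labels G F (s.arr .lab)) (hcnt : s.var .cnt = 0) :
    ((Stmt.loop .u .n countBody).eval M s).var .cnt = F.card := by
  classical
  have := Stmt.loop_rule M (i := .u) (x := .n) (p := countBody) (s := s)
    (fun m s' => s'.var .cnt = (Finset.univ.filter fun a : Fin n =>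
      (a : ℕ) < m ∧ a ∈ F).card) (by simp [hcnt]) (by
      intro m hm s' fv fa ih
      rw [hn] at hm
      have hlab := hF.mem ⟨m, hm⟩
      rw [← fa .lab rfl] at hlab
      rw [card_filter_lt_succ (fun a => a ∈ F) hm, ← ih]
      simp only [countBody, incr, Stmt.eval, Expr.eval, Env.set_var, Env.set_arr, if_true]
      simp only [hlab]
      split_ifs <;> simp_all [Env.set_var])
  rw [hn] at this
  rw [this]
  congr 1
  ext a
  simp

/-! ### The search -/

/-- Tests the instruction list with number `w`. -/
def guessCode : Stmt :=
  .loop .u .n (.put .lab (.var .u) (.lit 0)) ;;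
  .loop .u .n (.put .mark (.var .u) (.lit 0)) ;;
  .set .t (.var .w) ;;
  .loop .z .pow digitBody ;;
  .loop .x .n leafBody ;;
  .loop .x .n tryBody ;;
  .set .cnt (.lit 0) ;;
  .loop .u .n countBody ;;
  .ite (.sub (.add (.var .k) (.var .cnt)) (.var .n)) .skip (.set .ans (.lit 1))

theorem eval_guessCode {M : ℕ → ℕ} {s : Env} (h : Prepared G C M s) (hw : s.var .w < s.var .pow) :
    (guessCode.eval M s).var .ans =
      if s.var .k + (G.build pickLast C (List.finRange n) (instrs n C.card (2 * C.card + 2)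
        (s.arr .lst) (s.var .pow) (s.var .w))).card ≤ n then 1 else s.var .ans := by
  rw [guessCode]
  simp only [Stmt.eval_seq]
  have c1 := eval_clear M (a := .lab) (u := .u) h.size
  have h1 : Prepared G C M ((Stmt.loop .u .n (.put .lab (.var .u) (.lit 0))).eval M s) := h.eval rfl
  have v1 : ∀ y, y ≠ .u →
      ((Stmt.loop .u .n (.put .lab (.var .u) (.lit 0))).eval M s).var y = s.var y :=
    fun y hy => Stmt.eval_var M (by simp [Stmt.writes, hy]) _
  have a1 : ((Stmt.loop .u .n (.put .lab (.var .u) (.lit 0))).eval M s).arr .lst = s.arr .lst :=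
    Stmt.eval_arr M rfl _
  generalize (Stmt.loop .u .n (.put .lab (.var .u) (.lit 0))).eval M s = s₁ at c1 h1 v1 a1 ⊢
  have c2 := eval_clear M (a := .mark) (u := .u) h1.size
  have h2 : Prepared G C M ((Stmt.loop .u .n (.put .mark (.var .u) (.lit 0))).eval M s₁) :=
    h1.eval rfl
  have v2 : ∀ y, y ≠ .u →
      ((Stmt.loop .u .n (.put .mark (.var .u) (.lit 0))).eval M s₁).var y = s.var y :=
    fun y hy => (Stmt.eval_var M (by simp [Stmt.writes, hy]) _).trans (v1 y hy)
  have a2 : ((Stmt.loop .u .n (.put .mark (.var .u) (.lit 0))).eval M s₁).arr .lst = s.arr .lst :=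
    (Stmt.eval_arr M rfl _).trans a1
  have l2 : ((Stmt.loop .u .n (.put .mark (.var .u) (.lit 0))).eval M s₁).arr .lab = s₁.arr .lab :=
    Stmt.eval_arr M rfl _
  generalize (Stmt.loop .u .n (.put .mark (.var .u) (.lit 0))).eval M s₁ = s₂
    at c2 h2 v2 a2 l2 ⊢
  have w3 : ((Stmt.set .t (.var .w)).eval M s₂).var .t = s.var .w := v2 .w (by simp)
  have v3 : ∀ y, y ≠ .u → y ≠ .t → ((Stmt.set .t (.var .w)).eval M s₂).var y = s.var y :=
    fun y hy hy' => (Stmt.eval_var M (by simp [Stmt.writes, hy']) _).trans (v2 y hy)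
  have h3 : Prepared G C M ((Stmt.set .t (.var .w)).eval M s₂) := h2.eval rfl
  have σ3 : Holds G (∅, ∅) ((Stmt.set .t (.var .w)).eval M s₂) := by
    refine ⟨Labels.empty fun v hv => ?_, fun v => ?_⟩
    · have : ((Stmt.set .t (.var .w)).eval M s₂).arr .lab = s₁.arr .lab := l2
      rw [this, c1 v hv]
    · have : ((Stmt.set .t (.var .w)).eval M s₂).arr .mark = s₂.arr .mark := rfl
      simp [this, c2 v v.2]
  have a3 : ((Stmt.set .t (.var .w)).eval M s₂).arr .lst = s.arr .lst := a2
  generalize (Stmt.set .t (.var .w)).eval M s₂ = s₃ at w3 v3 h3 σ3 a3 ⊢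
  have p3 : s₃.var .pow = s.var .pow := v3 _ (by simp) (by simp)
  have l4 := (eval_digits h3 σ3 (by rw [w3, p3]; exact hw)).lab
  rw [a3, w3, p3] at l4
  have h4 : Prepared G C M ((Stmt.loop .z .pow digitBody).eval M s₃) := h3.eval rfl
  have k4 : ((Stmt.loop .z .pow digitBody).eval M s₃).var .k = s.var .k :=
    (Stmt.eval_var M rfl _).trans (v3 _ (by simp) (by simp))
  have r4 : ((Stmt.loop .z .pow digitBody).eval M s₃).var .ans = s.var .ans :=
    (Stmt.eval_var M rfl _).trans (v3 _ (by simp) (by simp))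
  generalize (Stmt.loop .z .pow digitBody).eval M s₃ = s₄ at l4 h4 k4 r4 ⊢
  have l5 := eval_leaves h4 l4
  have h5 : Prepared G C M ((Stmt.loop .x .n leafBody).eval M s₄) := h4.eval rfl
  have k5 : ((Stmt.loop .x .n leafBody).eval M s₄).var .k = s.var .k :=
    (Stmt.eval_var M rfl _).trans k4
  have r5 : ((Stmt.loop .x .n leafBody).eval M s₄).var .ans = s.var .ans :=
    (Stmt.eval_var M rfl _).trans r4
  generalize (Stmt.loop .x .n leafBody).eval M s₄ = s₅ at l5 h5 k5 r5 ⊢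
  have l6 := eval_tries h5 l5
  have h6 : Prepared G C M ((Stmt.loop .x .n tryBody).eval M s₅) := h5.eval rfl
  have k6 : ((Stmt.loop .x .n tryBody).eval M s₅).var .k = s.var .k :=
    (Stmt.eval_var M rfl _).trans k5
  have r6 : ((Stmt.loop .x .n tryBody).eval M s₅).var .ans = s.var .ans :=
    (Stmt.eval_var M rfl _).trans r5
  generalize (Stmt.loop .x .n tryBody).eval M s₅ = s₆ at l6 h6 k6 r6 ⊢
  set s₇ := (Stmt.set .cnt (.lit 0)).eval M s₆ with hs₇
  have c8 := eval_count M (s := s₇) h6.size l6 rfl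
  have h8 : Prepared G C M ((Stmt.loop .u .n countBody).eval M s₇) := (h6.eval rfl).eval rfl
  have k8 : ((Stmt.loop .u .n countBody).eval M s₇).var .k = s.var .k :=
    (Stmt.eval_var M rfl _).trans k6
  have r8 : ((Stmt.loop .u .n countBody).eval M s₇).var .ans = s.var .ans :=
    (Stmt.eval_var M rfl _).trans r6
  generalize (Stmt.loop .u .n countBody).eval M s₇ = s₈ at c8 h8 k8 r8 ⊢
  rw [build, complete, ← c8]
  split_ifs with hc
  · rw [Stmt.eval_ite_neg (by simp only [Expr.eval, k8, h8.size]; omega)]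
    simp [Stmt.eval, Expr.eval, Env.set_var]
  · rw [Stmt.eval_ite_pos (by simp only [Expr.eval, k8, h8.size]; omega)]
    exact r8

/-- Tests all instruction lists. -/
def searchCode : Stmt :=
  .set .ans (.lit 0) ;; .loop .w .pow guessCode

open Classical in
theorem eval_searchCode {M : ℕ → ℕ} {s : Env} (h : Prepared G C M s) :
    (searchCode.eval M s).var .ans = if ∃ w < s.var .pow,
      s.var .k + (G.build pickLast C (List.finRange n) (instrs n C.card (2 * C.card + 2)
        (s.arr .lst) (s.var .pow) w)).card ≤ n then 1 else 0 := by
  rw [searchCode, Stmt.eval_seq]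
  set s₁ := (Stmt.set .ans (.lit 0)).eval M s with hs₁
  have h₁ : Prepared G C M s₁ := h.eval rfl
  have := Stmt.loop_rule M (i := .w) (x := .pow) (p := guessCode) (s := s₁)
    (fun m s' => s'.var .ans = if ∃ w < m,
      s.var .k + (G.build pickLast C (List.finRange n) (instrs n C.card (2 * C.card + 2)
        (s.arr .lst) (s.var .pow) w)).card ≤ n then 1 else 0)
    (by simp [hs₁, Stmt.eval, Expr.eval, Env.set_var]) (by
      intro m hm s' fv fa ih
      have hP : Prepared G C M (s'.set .w m) := (h₁.of_keeps rfl fv fa).set (by simp) m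
      have hp : (s'.set .w m).var .pow = s.var .pow := fv .pow rfl
      have hk : (s'.set .w m).var .k = s.var .k := fv .k rfl
      have hl : (s'.set .w m).arr .lst = s.arr .lst := fa .lst rfl
      have hwm : (s'.set .w m).var .w = m := by simp [Env.set_var]
      have ha : (s'.set .w m).var .ans = s'.var .ans := rfl
      have hlt : m < s.var .pow := hm
      rw [eval_guessCode hP (by rw [hp, hwm]; exact hlt), hp, hk, hl, hwm, ha, ih]
      have hor : ∀ (A B : Prop) [Decidable A] [Decidable B] [Decidable (A ∨ B)],
          (if A then 1 else if B then 1 else 0) = if A ∨ B then 1 else 0 := by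
        intro A B _ _ _
        by_cases hA : A <;> by_cases hB : B <;> simp [hA, hB]
      have hex : ∀ P : ℕ → Prop, (∃ w < m + 1, P w) ↔ P m ∨ ∃ w < m, P w := by
        intro P
        constructor
        · rintro ⟨w, hw, hPw⟩
          rcases Nat.lt_succ_iff_lt_or_eq.1 hw with hw | rfl
          · exact Or.inr ⟨w, hw, hPw⟩
          · exact Or.inl hPw
        · rintro (hP | ⟨w, hw, hPw⟩)
          · exact ⟨m, by omega, hP⟩
          · exact ⟨w, by omega, hPw⟩
      simp only [hex]
      exact hor _ _)
  exact this

/-! ### Correctness of the search -/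

theorem Prepared.exists_decode {M : ℕ → ℕ} {s : Env} (h : Prepared G C M s) {i : Instr (Fin n)}
    (hi : i.Over C) : ∃ d < 2 * C.card + 2, decode n C.card (s.arr .lst) d = i := by
  cases i with
  | nop => exact ⟨0, by omega, rfl⟩
  | flush => exact ⟨1, by omega, rfl⟩
  | add v =>
    obtain ⟨j, hj, hjv⟩ := h.lst_surj v hi
    refine ⟨j + 2, by omega, ?_⟩
    have hlt : s.arr .lst (j + 2 - 2) < n := by rw [Nat.add_sub_cancel, hjv]; exact v.2
    rw [decode, if_neg (by omega), if_neg (by omega), if_pos (by omega), dif_pos hlt]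
    congr 1
    exact Fin.ext (by simpa using hjv)
  | mark v =>
    obtain ⟨j, hj, hjv⟩ := h.lst_surj v hi
    refine ⟨j + C.card + 2, by omega, ?_⟩
    have hlt : s.arr .lst (j + C.card + 2 - 2 - C.card) < n := by
      rw [Nat.add_sub_cancel, Nat.add_sub_cancel, hjv]; exact v.2
    rw [decode, if_neg (by omega), if_neg (by omega), if_neg (by omega), dif_pos hlt]
    congr 1
    exact Fin.ext (by simpa using hjv)

theorem Prepared.exists_digits {M : ℕ → ℕ} {s : Env} (h : Prepared G C M s)
    {is : List (Instr (Fin n))} (his : ∀ i ∈ is, i.Over C) :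
    ∃ ds : List ℕ, (∀ d ∈ ds, d < 2 * C.card + 2) ∧ ds.length = is.length ∧
      ds.map (decode n C.card (s.arr .lst)) = is := by
  induction is with
  | nil => exact ⟨[], by simp⟩
  | cons i is ih =>
    obtain ⟨ds, h1, h2, h3⟩ := ih (fun j hj => his j (by simp [hj]))
    obtain ⟨d, hd, hdi⟩ := h.exists_decode (his i (by simp))
    exact ⟨d :: ds, by simpa [hd] using h1, by simp [h2], by simp [hdi, h3]⟩

/-- Surplus digits are zero and decode to `nop`, so reading more digits than the list has changes
nothing. -/
theorem foldl_instrs_ofDigits {c b : ℕ} {lst : ℕ → ℕ} (hb : 1 < b)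
    (pick : (Fin n → Prop) → Option (Fin n)) {ds : List ℕ} (hds : ∀ d ∈ ds, d < b) {N : ℕ}
    (hN : ds.length ≤ N) (σ : Finset (Fin n) × Finset (Fin n)) :
    (instrs n c b lst N (Nat.ofDigits b ds)).foldl (Instr.run G pick C) σ =
      (ds.map (decode n c lst)).foldl (Instr.run G pick C) σ := by
  induction ds generalizing N σ with
  | nil =>
    have hz : ∀ N, instrs n c b lst N 0 = List.replicate N .nop := by
      intro N
      induction N with
      | zero => rfl
      | succ N ih =>
        rw [instrs, List.range_succ, List.map_append, List.replicate_succ', ← ih, instrs]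
        simp [decode]
    rw [Nat.ofDigits_nil, hz]
    clear hN
    induction N with
    | zero => rfl
    | succ N ih => rw [List.replicate_succ, List.foldl_cons]; exact ih
  | cons d ds ih =>
    obtain ⟨N, rfl⟩ : ∃ N', N = N' + 1 := ⟨N - 1, by simp at hN; omega⟩
    have hd : d < b := hds d (by simp)
    have h0 : Nat.ofDigits b (d :: ds) % b = d := by
      rw [Nat.ofDigits_cons, Nat.add_mul_mod_self_left, Nat.mod_eq_of_lt hd]
    have h1 : Nat.ofDigits b (d :: ds) / b = Nat.ofDigits b ds := by
      rw [Nat.ofDigits_cons, Nat.add_mul_div_left _ _ (by omega), Nat.div_eq_of_lt hd, Nat.zero_add]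
    have hcons : instrs n c b lst (N + 1) (Nat.ofDigits b (d :: ds)) =
        decode n c lst d :: instrs n c b lst N (Nat.ofDigits b ds) := by
      rw [instrs, List.range_succ_eq_map, List.map_cons, List.map_map, pow_zero, Nat.div_one, h0,
        instrs, ← h1]
      congr 1
      refine List.map_congr_left fun j _ => ?_
      simp [Nat.div_div_eq_div_mul, pow_succ']
    rw [hcons, List.foldl_cons, List.map_cons, List.foldl_cons]
    exact ih (fun x hx => hds x (by simp [hx])) (by simpa using hN) _

/-- A positive test is sound for every number w, since `build` always returns a maximal forest. For
the converse, a list of at most 4|C| digits encodes a number below `pow`. -/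
theorem Prepared.search_iff {M : ℕ → ℕ} {s : Env} (h : Prepared G C M s)
    (hC : ∀ u v, G.Adj u v → u ∈ C ∨ v ∈ C) (hpow : s.var .pow = (2 * C.card + 2) ^ (4 * C.card))
    (k : ℕ) :
    (∃ w < s.var .pow, k + (G.build pickLast C (List.finRange n) (instrs n C.card
      (2 * C.card + 2) (s.arr .lst) (s.var .pow) w)).card ≤ n) ↔ MaxMinFVS G k := by
  constructor
  · rintro ⟨w, -, hw⟩
    rw [maxMinFVS_iff]
    exact ⟨_, isMaxForest_build _ List.mem_finRange _, by simpa using hw⟩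
  · intro hk
    rw [maxMinFVS_iff_exists_build (pick := pickLast) (C := C) (fun P v => lastSat_some)
      (fun P hP v => lastSat_none hP v v.2) hC List.mem_finRange] at hk
    obtain ⟨is, h1, h2, h3⟩ := hk
    obtain ⟨ds, d1, d2, d3⟩ := h.exists_digits h1
    refine ⟨Nat.ofDigits (2 * C.card + 2) ds, ?_, ?_⟩
    · rw [hpow]
      exact (Nat.ofDigits_lt_base_pow_length (by omega) d1).trans_le
        (Nat.pow_le_pow_right (by omega) (by omega))
    · rw [build, foldl_instrs_ofDigits (by omega) _ d1, d3]
      · simpa [build] using h3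
      · rw [hpow, d2]
        exact h2.trans (Nat.lt_pow_self (by omega)).le

end RAM

/-! ### Preparations, the machine program, and its running time. -/

namespace RAM

open SimpleGraph

variable {n : ℕ} {G : SimpleGraph (Fin n)} {C : Finset (Fin n)}

/-! ### Preparations: row addresses, a vertex cover, the number of instruction lists -/

/-- Without multiplication on the machine, the row addresses i · n are accumulated by addition. -/
def rowBody : Stmt := .put .row (.var .i) (.var .acc) ;; .set .acc (.add (.var .acc) (.var .n))

def addEdge : Stmt :=
  .put .cov (.var .i) (.lit 1) ;;
  .put .cov (.var .j) (.lit 1) ;;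
  .put .lst (.var .c) (.var .i) ;;
  .set .c (.add (.var .c) (.lit 1)) ;;
  .put .lst (.var .c) (.var .j) ;;
  .set .c (.add (.var .c) (.lit 1))

/-- Greedy maximal matching: an edge with both ends free is taken, and every other edge is already
covered. -/
def coverBody : Stmt :=
  .ite (adjE .i .j) (.ite (.get .cov (.var .i)) .skip (.ite (.get .cov (.var .j)) .skip addEdge))
    .skip

def prepareCode : Stmt :=
  .loop .i .n rowBody ;;
  .loop .i .n (.loop .j .n coverBody) ;;
  .set .b (.add (.add (.var .c) (.var .c)) (.lit 2)) ;;
  .set .pow (.lit 1)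

/-- Multiplies `pow` by `b`. -/
def mulCode : Stmt :=
  .set .acc (.lit 0) ;;
  .loop .j .b (.set .acc (.add (.var .acc) (.var .pow))) ;;
  .set .pow (.var .acc)

def powCode : Stmt := .loop .i .c (mulCode ;; mulCode ;; mulCode ;; mulCode)

theorem eval_rows (M : ℕ → ℕ) {s : Env} (hacc : s.var .acc = 0) :
    ∀ i < s.var .n, ((Stmt.loop .i .n rowBody).eval M s).arr .row i = i * s.var .n := by
  refine (Stmt.loop_rule M (i := .i) (x := .n) (p := rowBody) (s := s)
    (fun m s' => s'.var .acc = m * s.var .n ∧ ∀ i < m, s'.arr .row i = i * s.var .n)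
    (by simp [hacc]) ?_).2
  rintro m hm s' fv - ⟨i1, i2⟩
  simp only [rowBody, Stmt.eval, Expr.eval, Env.set_var, Env.set_arr, Env.put_var, Env.put_arr,
    if_true, if_false, reduceCtorEq, true_and, fv .n rfl, i1]
  refine ⟨by ring, fun i hi => ?_⟩
  split_ifs with him
  · rw [him]
  · exact i2 i (by omega)

/-- The endpoints `C` of a matching are available as a list and as a characteristic function. -/
structure Covers (G : SimpleGraph (Fin n)) (C : Finset (Fin n)) (s : Env) : Prop where
  cov : ∀ v : Fin n, s.arr .cov v ≠ 0 ↔ v ∈ C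
  card : s.var .c = C.card
  lst_lt : ∀ i < C.card, s.arr .lst i < n
  lst_surj : ∀ v ∈ C, ∃ i < C.card, s.arr .lst i = (v : ℕ)
  half : ∀ X : Finset (Fin n), (∀ u v, G.Adj u v → u ∈ X ∨ v ∈ X) → C.card ≤ 2 * (C ∩ X).card

theorem Covers.congr {s s' : Env} (h : Covers G C s) (hc : s'.var .c = s.var .c)
    (hcov : s'.arr .cov = s.arr .cov) (hlst : s'.arr .lst = s.arr .lst) : Covers G C s' :=
  ⟨by rw [hcov]; exact h.cov, by rw [hc]; exact h.card, by rw [hlst]; exact h.lst_lt,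
    by rw [hlst]; exact h.lst_surj, h.half⟩

/-- A matching edge puts two vertices into C, at least one of which belongs to any given vertex
cover X. Stating `half` with C ∩ X instead of X makes this bound inductive. -/
theorem Covers.addEdge {s : Env} (h : Covers G C s) (M : ℕ → ℕ) {a b : Fin n}
    (ha : s.var .i = a) (hb : s.var .j = b) (hab : G.Adj a b) (haC : a ∉ C) (hbC : b ∉ C) :
    Covers G (insert a (insert b C)) (addEdge.eval M s) := by
  have haC' : a ∉ insert b C := by simp [haC, hab.ne]
  have hcard : (insert a (insert b C)).card = C.card + 2 := by
    rw [Finset.card_insert_of_notMem haC', Finset.card_insert_of_notMem hbC]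
  have hlst : ∀ i, (RAM.addEdge.eval M s).arr .lst i =
      if i = C.card + 1 then (b : ℕ) else if i = C.card then (a : ℕ) else s.arr .lst i := by
    intro i
    simp [RAM.addEdge, Stmt.eval, Expr.eval, Env.set_var, Env.set_arr, Env.put_var, Env.put_arr,
      ha, hb, h.card]
  refine ⟨fun v => ?_, ?_, fun i hi => ?_, fun v hv => ?_, fun X hX => ?_⟩
  · simp only [RAM.addEdge, Stmt.eval, Expr.eval, Env.set_var, Env.set_arr, Env.put_var,
      Env.put_arr, ha, hb, Finset.mem_insert, Fin.ext_iff, reduceCtorEq, false_and, if_false,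
      true_and]
    split_ifs with h1 h2
    · simp [h1]
    · simp [h2]
    · simp [h1, h2, h.cov]
  · rw [hcard]
    simp [RAM.addEdge, Stmt.eval, Expr.eval, Env.set_var, Env.put_var, h.card]
  · rw [hlst]
    split_ifs
    · exact b.2
    · exact a.2
    · exact h.lst_lt i (by omega)
  · rw [hcard]
    rcases Finset.mem_insert.1 hv with rfl | hv
    · exact ⟨C.card, by omega, by rw [hlst, if_neg (by omega), if_pos rfl]⟩
    rcases Finset.mem_insert.1 hv with rfl | hv
    · exact ⟨C.card + 1, by omega, by rw [hlst, if_pos rfl]⟩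
    · obtain ⟨i, hi, hiv⟩ := h.lst_surj v hv
      exact ⟨i, by omega, by rw [hlst, if_neg (by omega), if_neg (by omega), hiv]⟩
  · have := h.half X hX
    have hstep : (C ∩ X).card + 1 ≤ (insert a (insert b C) ∩ X).card := by
      have key : ∀ x : Fin n, x ∉ C → x ∈ X → x ∈ insert a (insert b C) →
          (C ∩ X).card + 1 ≤ (insert a (insert b C) ∩ X).card := by
        intro x hxC hxX hx
        rw [← Finset.card_insert_of_notMem (a := x) (s := C ∩ X) (by simp [hxC])]
        refine Finset.card_le_card (Finset.insert_subset (Finset.mem_inter.2 ⟨hx, hxX⟩) ?_)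
        exact Finset.inter_subset_inter_right
          ((Finset.subset_insert b C).trans (Finset.subset_insert a _))
      rcases hX a b hab with hx | hx
      · exact key a haC hx (by simp)
      · exact key b hbC hx (by simp)
    rw [hcard]
    omega

theorem eval_coverBody {M : ℕ → ℕ} {s : Env} (h : Covers G C s) (hM : HasMatrix G M s)
    {a b : Fin n} (ha : s.var .i = a) (hb : s.var .j = b) :
    ∃ C', C ⊆ C' ∧ Covers G C' (coverBody.eval M s) ∧ (G.Adj a b → a ∈ C' ∨ b ∈ C') := by
  have hadj := hM.eval_adjE ha hb
  have hca : (Expr.get .cov (.var .i)).eval M s ≠ 0 ↔ a ∈ C := by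
    simp only [Expr.eval, ha]
    exact h.cov a
  have hcb : (Expr.get .cov (.var .j)).eval M s ≠ 0 ↔ b ∈ C := by
    simp only [Expr.eval, hb]
    exact h.cov b
  rw [coverBody]
  by_cases h1 : G.Adj a b
  · rw [Stmt.eval_ite_pos (hadj.2 h1)]
    by_cases h2 : a ∈ C
    · rw [Stmt.eval_ite_pos (hca.2 h2)]
      exact ⟨C, subset_rfl, h, fun _ => Or.inl h2⟩
    · rw [Stmt.eval_ite_neg (fun hc => h2 (hca.1 hc))]
      by_cases h3 : b ∈ C
      · rw [Stmt.eval_ite_pos (hcb.2 h3)]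
        exact ⟨C, subset_rfl, h, fun _ => Or.inr h3⟩
      · rw [Stmt.eval_ite_neg (fun hc => h3 (hcb.1 hc))]
        exact ⟨_, (Finset.subset_insert b C).trans (Finset.subset_insert a _),
          h.addEdge M ha hb h1 h2 h3, fun _ => Or.inl (by simp)⟩
  · rw [Stmt.eval_ite_neg (fun hc => h1 (hadj.1 hc))]
    exact ⟨C, subset_rfl, h, fun hc => absurd hc h1⟩

theorem eval_coverRow {M : ℕ → ℕ} {s : Env} (h : Covers G C s) (hM : HasMatrix G M s)
    {a : Fin n} (ha : s.var .i = a) :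
    ∃ C', C ⊆ C' ∧ Covers G C' ((Stmt.loop .j .n coverBody).eval M s) ∧
      ∀ b, G.Adj a b → a ∈ C' ∨ b ∈ C' := by
  have := Stmt.loop_rule M (i := .j) (x := .n) (p := coverBody) (s := s)
    (fun m s' => ∃ C', C ⊆ C' ∧ Covers G C' s' ∧
      ∀ b : Fin n, (b : ℕ) < m → G.Adj a b → a ∈ C' ∨ b ∈ C')
    ⟨C, subset_rfl, h, by simp⟩ (by
      rintro m hm s' fv fa ⟨C₁, i1, i2, i3⟩
      rw [hM.size] at hm
      have hM' : HasMatrix G M (s'.set .j m) := hM.congr (fv .n rfl) (fa .row rfl)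
      obtain ⟨C₂, j1, j2, j3⟩ := eval_coverBody (b := ⟨m, hm⟩)
        (i2.congr (s' := s'.set .j m) rfl rfl rfl) hM' ((fv .i rfl).trans ha)
        (by simp [Env.set_var])
      refine ⟨C₂, i1.trans j1, j2, fun b hb hab => ?_⟩
      rcases Nat.lt_succ_iff_lt_or_eq.1 hb with hb | hb
      · exact (i3 b hb hab).imp (fun h => j1 h) (fun h => j1 h)
      · obtain rfl : b = ⟨m, hm⟩ := Fin.ext hb
        exact j3 hab)
  rw [hM.size] at this
  obtain ⟨C', h1, h2, h3⟩ := this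
  exact ⟨C', h1, h2, fun b => h3 b b.2⟩

theorem eval_cover {M : ℕ → ℕ} {s : Env} (h : Covers G ∅ s) (hM : HasMatrix G M s) :
    ∃ C, Covers G C ((Stmt.loop .i .n (.loop .j .n coverBody)).eval M s) ∧
      ∀ a b, G.Adj a b → a ∈ C ∨ b ∈ C := by
  have := Stmt.loop_rule M (i := .i) (x := .n) (p := .loop .j .n coverBody) (s := s)
    (fun m s' => ∃ C, Covers G C s' ∧
      ∀ a : Fin n, (a : ℕ) < m → ∀ b, G.Adj a b → a ∈ C ∨ b ∈ C)
    ⟨∅, h, by simp⟩ (by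
      rintro m hm s' fv fa ⟨C₁, i2, i3⟩
      rw [hM.size] at hm
      have hM' : HasMatrix G M (s'.set .i m) := hM.congr (fv .n rfl) (fa .row rfl)
      obtain ⟨C₂, j1, j2, j3⟩ := eval_coverRow (a := ⟨m, hm⟩)
        (i2.congr (s' := s'.set .i m) rfl rfl rfl) hM' (by simp [Env.set_var])
      refine ⟨C₂, j2, fun a ha b hab => ?_⟩
      rcases Nat.lt_succ_iff_lt_or_eq.1 ha with ha | ha
      · exact (i3 a ha b hab).imp (fun h => j1 h) (fun h => j1 h)
      · obtain rfl : a = ⟨m, hm⟩ := Fin.ext ha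
        exact j3 b hab)
  rw [hM.size] at this
  obtain ⟨C, h1, h2⟩ := this
  exact ⟨C, h1, fun a => h2 a a.2⟩

theorem eval_prepareCode {M : ℕ → ℕ} {s : Env} (hn : s.var .n = n)
    (hM : ∀ i j : Fin n, M (i * n + j) ≠ 0 ↔ G.Adj i j) (hacc : s.var .acc = 0)
    (hc : s.var .c = 0) (hcov : ∀ i, s.arr .cov i = 0) :
    ∃ C : Finset (Fin n), Prepared G C M (prepareCode.eval M s) ∧
      (prepareCode.eval M s).var .pow = 1 ∧ (∀ u v, G.Adj u v → u ∈ C ∨ v ∈ C) ∧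
      ∀ X : Finset (Fin n), (∀ u v, G.Adj u v → u ∈ X ∨ v ∈ X) → C.card ≤ 2 * X.card := by
  rw [prepareCode, Stmt.eval_seq, Stmt.eval_seq, Stmt.eval_seq]
  have hrow := eval_rows M hacc
  have n1 : ((Stmt.loop .i .n rowBody).eval M s).var .n = n := (Stmt.eval_var M rfl _).trans hn
  have c1 : ((Stmt.loop .i .n rowBody).eval M s).var .c = 0 := (Stmt.eval_var M rfl _).trans hc
  have v1 : ((Stmt.loop .i .n rowBody).eval M s).arr .cov = s.arr .cov := Stmt.eval_arr M rfl _
  generalize (Stmt.loop .i .n rowBody).eval M s = s₁ at hrow n1 c1 v1 ⊢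
  rw [hn] at hrow
  have hM₁ : HasMatrix G M s₁ := ⟨n1, hrow, hM⟩
  have hC₁ : Covers G ∅ s₁ := ⟨by simp [v1, hcov], by simp [c1], by simp, by simp, by simp⟩
  obtain ⟨C, hC, hcover⟩ := eval_cover hC₁ hM₁
  have hM₂ : HasMatrix G M ((Stmt.loop .i .n (.loop .j .n coverBody)).eval M s₁) :=
    hM₁.congr (Stmt.eval_var M rfl _) (Stmt.eval_arr M rfl _)
  generalize (Stmt.loop .i .n (.loop .j .n coverBody)).eval M s₁ = s₂ at hC hM₂ ⊢
  refine ⟨C, ⟨hM₂.congr rfl rfl, hC.cov, hC.card, ?_, hC.lst_lt, hC.lst_surj⟩, rfl, hcover,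
    fun X hX => (hC.half X hX).trans ?_⟩
  · have : s₂.var .c + s₂.var .c + 2 = 2 * C.card + 2 := by
      rw [hC.card]
      ring
    exact this
  · exact Nat.mul_le_mul_left 2 (Finset.card_le_card Finset.inter_subset_right)

theorem eval_mulCode (M : ℕ → ℕ) (s : Env) :
    (mulCode.eval M s).var .pow = s.var .b * s.var .pow := by
  rw [mulCode, Stmt.eval_seq, Stmt.eval_seq]
  have := Stmt.loop_rule M (i := .j) (x := .b) (p := .set .acc (.add (.var .acc) (.var .pow)))
    (s := (Stmt.set .acc (.lit 0)).eval M s) (fun m s' => s'.var .acc = m * s.var .pow)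
    (by simp [Stmt.eval, Expr.eval, Env.set_var]) (by
      intro m hm s' fv _ ih
      have hp : s'.var .pow = s.var .pow := fv .pow rfl
      simp only [Stmt.eval, Expr.eval, Env.set_var, reduceCtorEq, if_false, if_true, ih, hp]
      ring)
  exact this

/-- Four multiplications by b in each of c rounds produce the exponent 4c, the length of the
instruction lists. -/
theorem eval_powCode (M : ℕ → ℕ) {s : Env} (hp : s.var .pow = 1) :
    (powCode.eval M s).var .pow = s.var .b ^ (4 * s.var .c) := by
  refine Stmt.loop_rule M (i := .i) (x := .c) (p := mulCode ;; mulCode ;; mulCode ;; mulCode)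
    (s := s) (fun m s' => s'.var .pow = s.var .b ^ (4 * m)) (by simp [hp]) ?_
  intro m hm s' fv _ ih
  have hb : ∀ s, (mulCode.eval M s).var .b = s.var .b := fun s => Stmt.eval_var M rfl s
  have h1 : (s'.set .i m).var .pow = s'.var .pow := rfl
  have h2 : (s'.set .i m).var .b = s.var .b := fv .b rfl
  simp only [Stmt.eval_seq, eval_mulCode, hb, h1, h2, ih]
  ring

theorem card_le_two_mul_vc (h : ∀ X : Finset (Fin n), (∀ u v, G.Adj u v → u ∈ X ∨ v ∈ X) →
    C.card ≤ 2 * X.card) : C.card ≤ 2 * vc G := by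
  classical
  obtain ⟨X, hX, hcov⟩ := G.vertexCoverNum_exists
  have hc := h X.toFinset (fun u v huv => by simpa using hcov huv)
  have : X.toFinset.card = vc G := by
    rw [← vc_spec, Set.encard_eq_coe_toFinset_card] at hX
    exact_mod_cast hX
  rwa [this] at hc

/-! ### The machine program -/

/-- Computes the number of cells of the input. -/
def squareCode : Prog :=
  .seq (.move 22 0) (.seq (.const 23 1)
    (.loop 22 (.seq (.add baseReg baseReg 0) (.sub 22 22 23))))

theorem exec_squareCode {s : State} (hb : s.reg baseReg = 0) :
    ∃ s', Exec squareCode s s' (3 * s.reg 0 + 3) ∧ s'.mem = s.mem ∧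
      s'.reg baseReg = s.reg 0 * s.reg 0 ∧ ∀ r < baseReg, s'.reg r = s.reg r := by
  have key : ∀ (d : ℕ) (s : State), s.reg 22 = d → s.reg 23 = 1 →
      ∃ s', Exec (.loop 22 (.seq (.add baseReg baseReg 0) (.sub 22 22 23))) s s' (3 * d + 1) ∧
        s'.mem = s.mem ∧ s'.reg baseReg = s.reg baseReg + d * s.reg 0 ∧
        ∀ r < baseReg, s'.reg r = s.reg r := by
    intro d
    induction d with
    | zero => exact fun s h1 h2 => ⟨s, .loop_done h1, rfl, by simp, fun _ _ => rfl⟩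
    | succ d ih =>
      intro s h1 h2
      set s₁ := s.setReg baseReg (s.reg baseReg + s.reg 0) with hs₁
      set s₂ := s₁.setReg 22 (s₁.reg 22 - s₁.reg 23) with hs₂
      obtain ⟨s', x, m, v, r⟩ := ih s₂ (by simp [hs₂, hs₁, State.setReg, baseReg, h1, h2])
        (by simp [hs₂, hs₁, State.setReg, baseReg, h2])
      have hr : ∀ r < baseReg, s₂.reg r = s.reg r := by
        intro r hr
        have e1 : r ≠ 22 := by simp only [baseReg] at hr; omega
        simp [hs₂, hs₁, State.setReg, e1, hr.ne]
      refine ⟨s', ?_, m, ?_, fun q hq => (r q hq).trans (hr q hq)⟩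
      · have := Exec.loop_step (by omega : s.reg 22 ≠ 0)
          (.seq (.add baseReg baseReg 0 s) (.sub 22 22 23 s₁)) x
        convert! this using 1
        omega
      · rw [v, hr 0 (by simp [baseReg])]
        simp only [hs₂, hs₁, State.setReg, baseReg, Function.update_apply]
        norm_num
        ring
  obtain ⟨s', x, m, v, r⟩ := key (s.reg 0) ((s.setReg 22 (s.reg 0)).setReg 23 1)
    (by simp [State.setReg]) (by simp [State.setReg])
  refine ⟨s', ?_, m, ?_, fun q hq => ?_⟩
  · have := Exec.seq (.move 22 0 s) (.seq (.const 23 1 _) x)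
    convert! this using 1
    omega
  · rw [v]
    simpa [State.setReg, baseReg] using hb
  · rw [r q hq]
    simp only [baseReg] at hq
    simp only [State.setReg, Function.update_apply]
    rw [if_neg (by omega), if_neg (by omega)]

def maxMinFVSCode : Prog :=
  .seq squareCode (.seq (prepareCode.compile 22) (.seq (powCode.compile 22)
    (.seq (searchCode.compile 22) (.move 0 Var.ans.idx))))

theorem input_mem_ne_zero_iff (k : ℕ) (i j : Fin n) :
    (input G k).mem (i * n + j) ≠ 0 ↔ G.Adj i j := by
  simp only [input]
  constructor
  · intro h
    split_ifs at h with hex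
    · obtain ⟨i', j', heq, hadj⟩ := hex
      have hj : (j : ℕ) = j' := by
        have := congrArg (· % n) heq
        simpa [Nat.mul_add_mod', Nat.mod_eq_of_lt j.2, Nat.mod_eq_of_lt j'.2] using this
      have hi : (i : ℕ) = i' := by
        have hn : 0 < n := i.pos
        have : (i : ℕ) * n = i' * n := by omega
        exact Nat.eq_of_mul_eq_mul_right hn this
      rwa [Fin.ext hi, Fin.ext hj]
    · exact absurd rfl h
  · intro h
    rw [if_pos ⟨i, j, rfl, h⟩]
    simp

theorem input_mem_of_le (k : ℕ) {a : ℕ} (ha : n * n ≤ a) : (input G k).mem a = 0 := by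
  simp only [input]
  rw [if_neg]
  rintro ⟨i, j, rfl, -⟩
  have h1 := i.2
  have h2 := j.2
  have : ((i : ℕ) + 1) * n ≤ n * n := Nat.mul_le_mul_right n h1
  rw [Nat.add_mul] at this
  omega

/-- The environment with all variables zero except `n` and `k`. -/
def initialEnv (n k : ℕ) : Env where
  var x := if x = .n then n else if x = .k then k else 0
  arr _ _ := 0

theorem input_represents (k : ℕ) {s : State} (hm : s.mem = (input G k).mem)
    (hb : s.reg baseReg = n * n) (hr : ∀ r < baseReg, s.reg r = (input G k).reg r) :
    Represents (input G k).mem (n * n) s (initialEnv n k) where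
  var x := by
    rw [hr _ x.idx_lt]
    cases x <;> simp [input, initialEnv, Var.idx]
  base := hb
  arr a i := by
    rw [hm]
    exact input_mem_of_le k (Nat.le_add_right _ _)
  inp i _ := by rw [hm]
  inp_zero i hi := input_mem_of_le k hi

/-- The three phases are compiled separately because a loop bound may not be written in the phase
that uses it: c and b come from the preparation, `pow` from `powCode`. -/
theorem exec_maxMinFVSCode : ∃ K D : ℕ, ∀ (n : ℕ) (G : SimpleGraph (Fin n)) (k : ℕ),
    ∃ (c : ℕ) (s : State) (τ : ℕ), c ≤ 2 * vc G ∧ Exec maxMinFVSCode (input G k) s τ ∧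
      τ ≤ K * ((n + 1) * (2 * c + 2) ^ (4 * c)) ^ D ∧
      (MaxMinFVS G k → s.reg 0 = 1) ∧ (¬ MaxMinFVS G k → s.reg 0 = 0) := by
  obtain ⟨K, D, hKD⟩ := (prepareCode ;; powCode ;; searchCode).cost_le
  -- The factor 4^D comes from m + 1 = 4(n + 1)N below. The summand 4 and the larger exponent pay
  -- for the 3n + 4 steps outside the compiled phases, even when D = 0.
  refine ⟨K * 4 ^ D + 4, D + 1, fun n G k => ?_⟩
  set M := (input G k).mem with hMdef
  obtain ⟨s₀, x₀, m₀, b₀, r₀⟩ := exec_squareCode (s := input G k) (by simp [input, baseReg])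
  have hn0 : (input G k).reg 0 = n := by simp [input]
  rw [hn0] at x₀ b₀
  have R₀ := input_represents k m₀ b₀ r₀
  obtain ⟨C, hprep, hpow, hcover, hhalf⟩ := eval_prepareCode (G := G) (M := M)
    (s := initialEnv n k) (by simp [initialEnv]) (input_mem_ne_zero_iff k)
    (by simp [initialEnv]) (by simp [initialEnv]) (fun _ => rfl)
  have hk1 : (prepareCode.eval M (initialEnv n k)).var .k = k :=
    (Stmt.eval_var M rfl _).trans (by simp [initialEnv])
  set e₁ := prepareCode.eval M (initialEnv n k) with he₁
  have hpow₂ := eval_powCode M hpow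
  have hprep₂ : Prepared G C M (powCode.eval M e₁) := hprep.eval rfl
  have hk2 : (powCode.eval M e₁).var .k = k := (Stmt.eval_var M rfl _).trans hk1
  rw [hprep.base, hprep.card] at hpow₂
  set e₂ := powCode.eval M e₁ with he₂
  set N := (2 * C.card + 2) ^ (4 * C.card) with hN
  have hN1 : 1 ≤ N := Nat.one_le_pow _ _ (by omega)
  have hCn : C.card ≤ n := by simpa using C.card_le_univ
  have hm : 4 * ((n + 1) * N) = 4 * (n * N) + 4 * N := by ring
  have hnN : n ≤ n * N := Nat.le_mul_of_pos_right n hN1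
  have hb0 : n ≤ 4 * ((n + 1) * N) - 1 := by omega
  have hb1 : 2 * C.card + 2 ≤ 4 * ((n + 1) * N) - 1 := by omega
  have hb2 : N ≤ 4 * ((n + 1) * N) - 1 := by omega
  -- One bound for every loop: it dominates n, c, b = 2c + 2 and N. Subtracting 1 gives m + 1 a
  -- product form.
  set m := 4 * ((n + 1) * N) - 1 with hmdef
  have hm1 : m + 1 = 4 * ((n + 1) * N) := by omega
  have h22 : baseReg < 22 := by simp [baseReg]
  obtain ⟨s₁, τ₁, x₁, c₁, R₁, -⟩ := prepareCode.exec_compile (m := m)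
    (B := fun x => x = Var.n) rfl h22 R₀ (by
      intro x hx
      obtain rfl : x = .n := by simpa using hx
      simpa [initialEnv] using hb0)
  obtain ⟨s₂, τ₂, x₂, c₂, R₂, -⟩ := powCode.exec_compile (m := m)
    (B := fun x => x = Var.c || x = Var.b) rfl h22 R₁ (by
      intro x hx
      have : x = .c ∨ x = .b := by simpa using hx
      rcases this with rfl | rfl
      · rw [hprep.card]
        omega
      · rw [hprep.base]
        exact hb1)
  obtain ⟨s₃, τ₃, x₃, c₃, R₃, -⟩ := searchCode.exec_compile (m := m)
    (B := fun x => x = Var.n || x = Var.pow) rfl h22 R₂ (by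
      intro x hx
      have : x = .n ∨ x = .pow := by simpa using hx
      rcases this with rfl | rfl
      · rw [hprep₂.size]
        exact hb0
      · rw [hpow₂]
        exact hb2)
  have hans := eval_searchCode hprep₂
  have hiff := hprep₂.search_iff hcover hpow₂ k
  rw [← hk2] at hiff
  have hres : (s₃.setReg 0 (s₃.reg Var.ans.idx)).reg 0 = (searchCode.eval M e₂).var .ans := by
    simp only [State.setReg, Function.update_self]
    exact R₃.var .ans
  refine ⟨C.card, _, _, card_le_two_mul_vc hhalf,
    .seq x₀ (.seq x₁ (.seq x₂ (.seq x₃ (.move _ _ _)))), ?_, fun hQ => ?_, fun hQ => ?_⟩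
  · have hcost : τ₁ + (τ₂ + τ₃) ≤ K * (m + 1) ^ D :=
      (Nat.add_le_add c₁ (Nat.add_le_add c₂ c₃)).trans (hKD m)
    rw [hm1, mul_pow] at hcost
    have hX : n + 1 ≤ (n + 1) * N := Nat.le_mul_of_pos_right _ hN1
    set X := (n + 1) * N with hXdef
    have hX1 : 1 ≤ X := by omega
    have hXD : X ^ D ≤ X ^ (D + 1) := Nat.pow_le_pow_right hX1 (by omega)
    have hXD' : X ≤ X ^ (D + 1) := Nat.le_self_pow (by omega) X
    calc 3 * n + 3 + (τ₁ + (τ₂ + (τ₃ + 1))) ≤ K * (4 ^ D * X ^ D) + 4 * X := by omega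
      _ ≤ K * (4 ^ D * X ^ (D + 1)) + 4 * X ^ (D + 1) := by gcongr
      _ = _ := by ring
  · rw [hres, hans, if_pos (hiff.2 (hk2.symm ▸ hQ))]
  · rw [hres, hans, if_neg (fun hc => hQ (hk2 ▸ hiff.1 hc))]

end RAM

/-! ### The bound in terms of the vertex cover number. -/

theorem pow_search_bound (c v : ℕ) (h : c ≤ 2 * v) :
    (2 * c + 2) ^ (4 * c) ≤ 6 ^ 8 * v ^ (32 * v) := by
  have h1 : (2 * c + 2) ^ (4 * c) ≤ (4 * v + 2) ^ (8 * v) :=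
    (Nat.pow_le_pow_left (by omega) _).trans (Nat.pow_le_pow_right (by omega) (by omega))
  refine h1.trans ?_
  rcases Nat.lt_or_ge v 2 with hv | hv
  -- For v at most 1 the power of v equals 1, and the constant must do the work: 6^8 is the value of
  -- the left side at v = 1.
  · interval_cases v <;> norm_num
  · have h2 : 4 * v + 2 ≤ v ^ 4 := by
      have : 2 ^ 3 ≤ v ^ 3 := Nat.pow_le_pow_left hv 3
      have h3 : 2 ^ 3 * v ≤ v ^ 3 * v := Nat.mul_le_mul_right v this
      have h4 : v ^ 3 * v = v ^ 4 := (pow_succ v 3).symm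
      omega
    calc (4 * v + 2) ^ (8 * v) ≤ (v ^ 4) ^ (8 * v) := Nat.pow_le_pow_left h2 _
      _ = v ^ (32 * v) := by rw [← pow_mul]; congr 1; ring
      _ ≤ 6 ^ 8 * v ^ (32 * v) := Nat.le_mul_of_pos_left _ (by norm_num)

theorem natCast_pow_mul_self_eq_rpow (B v : ℕ) :
    ((v : ℝ) ^ (B * v)) = (2 : ℝ) ^ ((B : ℝ) * ((v : ℝ) * Real.logb 2 v)) := by
  rcases Nat.eq_zero_or_pos v with rfl | hv
  · simp
  · have hv' : (0 : ℝ) < v := by exact_mod_cast hv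
    -- This needs v > 0; at v = 0 both sides of the claim are 1.
    have h2 : (2 : ℝ) ^ Real.logb 2 v = v := Real.rpow_logb (by norm_num) (by norm_num) hv'
    rw [show (B : ℝ) * ((v : ℝ) * Real.logb 2 v) = Real.logb 2 v * ((B * v : ℕ) : ℝ) by
      push_cast; ring, Real.rpow_mul (by norm_num), h2, Real.rpow_natCast]

theorem theorem2 :
    ∃ (p : RAM.Prog) (A B C : ℕ), ∀ (n : ℕ) (G : SimpleGraph (Fin n)) (k : ℕ),
      RAM.AnswersWithin p G k (MaxMinFVS G k)
        (A * (2 : ℝ) ^ ((B : ℝ) * ((vc G : ℝ) * Real.logb 2 (vc G))) * ((n : ℝ) + 1) ^ C) := by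
  obtain ⟨K, D, h⟩ := RAM.exec_maxMinFVSCode
  refine ⟨RAM.maxMinFVSCode, K * (6 ^ 8) ^ D, 32 * D, D, fun n G k => ?_⟩
  obtain ⟨c, s, τ, hc, hx, hτ, hyes, hno⟩ := h n G k
  refine ⟨s, τ, hx, ?_, hyes, hno⟩
  rw [← natCast_pow_mul_self_eq_rpow]
  have hle : τ ≤ K * (6 ^ 8) ^ D * vc G ^ (32 * D * vc G) * (n + 1) ^ D :=
    calc τ ≤ K * ((n + 1) * (2 * c + 2) ^ (4 * c)) ^ D := hτ
      _ ≤ K * ((n + 1) * (6 ^ 8 * vc G ^ (32 * vc G))) ^ D := by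
        gcongr
        exact pow_search_bound c (vc G) hc
      _ = _ := by
        rw [mul_pow, mul_pow, ← pow_mul (vc G), show 32 * vc G * D = 32 * D * vc G by ring]
        ring
  exact_mod_cast hle
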